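/- There is an absolute constant $C$ such that the following holds. Let $\mathbb H$ be a real separable Hilbert space (of finite or infinite dimension), let $\xi$ and $\eta$ be Gaussian random elements of $\mathbb H$, defined on a common probability space, with zero mean and covariance operators $\Sigma_\xi$ and $\Sigma_\eta$, and let $a\in\mathbb H$. Let $\lambda_{1\xi}\ge\lambda_{2\xi}\ge\dots\ge 0$ be the eigenvalues of $\Sigma_\xi$, repeated according to multiplicity and arranged in non-increasing order (if there are only finitely many positive ones, the sequence is continued by zeros), let $\Lambda_{k\xi}=\bigl(\sum_{j\ge k}\lambda_{j\xi}^2\bigr)^{1/2}$ for $k=1,2$, and let $$ \varkappa(\Sigma_\xi)= \begin{cases} \Lambda_{1\xi}^{-1}, & \text{if } 3\lambda_{1\xi}^2\le\Lambda_{1\xi}^2,\\ (\lambda_{1\xi}\Lambda_{2\xi})^{-1/2}, & \text{if } 3\lambda_{1\xi}^2>\Lambda_{1\xi}^2,\ 3\lambda_{2\xi}^2\le\Lambda_{2\xi}^2,\\ (\lambda_{1\xi}\lambda_{2\xi})^{-1/2}, & \text{if } 3\lambda_{1\xi}^2>\Lambda_{1\xi}^2,\ 3\lambda_{2\xi}^2>\Lambda_{2\xi}^2;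 \end{cases} $$ define $\lambda_{j\eta}$, $\Lambda_{k\eta}$ and $\varkappa(\Sigma_\eta)$ in the same way from $\Sigma_\eta$, and put $\|\lambda_\xi-\lambda_\eta\|_1=\sum_{j\ge1}|\lambda_{j\xi}-\lambda_{j\eta}|$. Here $0^{-1}=0^{-1/2}=\infty$, so that $\varkappa(\Sigma)=\infty$ if $\Sigma$ has rank at most one, and $\infty\cdot 0=0$. Then $$ \sup_{x>0}\bigl|P(\|\xi-a\|\le x)-P(\|\eta-a\|\le x)\bigr| \le C\,\bigl\{\varkappa(\Sigma_\xi)+\varkappa(\Sigma_\eta)\bigr\}\bigl(\|\lambda_\xi-\lambda_\eta\|_1+\|a\|^2\bigr). $$ -/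

import Mathlib

open MeasureTheory ProbabilityTheory
open scoped ENNReal NNReal

noncomputable section

namespace GaussianBalls

variable {H : Type*} [NormedAddCommGroup H] [InnerProductSpace ℝ H]

/-- The eigenvalues of a positive compact operator `T`, repeated according to multiplicity and
arranged in non-increasing order. The index starts at `0`: `eigenvalue T k` is `λ_{k+1}(T)`, the
largest `t > 0` such that the eigenspaces of `T` for the eigenvalues `≥ t` have total dimension
at least `k + 1`. If `T` has at most `k` positive eigenvalues (with multiplicity), there is no
such `t` and the value is `0`. -/
def eigenvalue (T : H →L[ℝ] H) (k : ℕ) : ℝ :=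
  sSup {t : ℝ | 0 < t ∧ (k : Cardinal) <
    Module.rank ℝ ↥(⨆ s ∈ Set.Ici t, Module.End.eigenspace (T : H →ₗ[ℝ] H) s)}

/-- `tailSq T k` is `Λ_{k+1}² = ∑_{j ≥ k+1} λ_j²` (in the numbering of `λ` that starts at `1`). -/
def tailSq (T : H →L[ℝ] H) (k : ℕ) : ℝ≥0∞ :=
  ∑' j : ℕ, ENNReal.ofReal (eigenvalue T (k + j) ^ 2)

/-- `tail T k` is `Λ_{k+1}`, the nonnegative square root of `Λ_{k+1}²`. -/
def tail (T : H →L[ℝ] H) (k : ℕ) : ℝ≥0∞ := tailSq T k ^ (1 / 2 : ℝ)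

/-- The quantity `ϰ(T)`, with values in `[0, ∞]`: it is `∞` when the denominator vanishes, which
for a covariance operator means that the rank of `T` is at most one. -/
def kappa (T : H →L[ℝ] H) : ℝ≥0∞ :=
  if 3 * ENNReal.ofReal (eigenvalue T 0 ^ 2) ≤ tailSq T 0 then
    (tail T 0)⁻¹
  else if 3 * ENNReal.ofReal (eigenvalue T 1 ^ 2) ≤ tailSq T 1 then
    (ENNReal.ofReal (eigenvalue T 0) * tail T 1) ^ (-(1 / 2) : ℝ)
  else
    (ENNReal.ofReal (eigenvalue T 0) * ENNReal.ofReal (eigenvalue T 1)) ^ (-(1 / 2) : ℝ)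

/-- The nuclear norm `∑_j |λ_j(S) - λ_j(T)|` of the difference of the diagonal operators
`diag (λ_j(S))` and `diag (λ_j(T))`. -/
def eigenvalueDist (S T : H →L[ℝ] H) : ℝ≥0∞ :=
  ∑' j : ℕ, ENNReal.ofReal |eigenvalue S j - eigenvalue T j|

end GaussianBalls

end

noncomputable section

namespace GaussianBalls

open Set Filter Topology

/-! In an eigenbasis of the covariance, `‖ξ - a‖ ^ 2` is a constant `r` plus a sum of squares of
independent Gaussians with variances `λ_j` and means `b_j`, where `∑ b_j ^ 2 + r ≤ ‖a‖ ^ 2`.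
Distribution functions of finite partial sums converge to that of the whole
(`exists_tendsto_quadLaw`), so finite quadratic forms are compared and a limit is taken.

Suppose that every form with variances at least `lam` has density at most `M`. Then three moves are
cheap. Raising one variance by `δ` costs at most `6 * M * δ` (`conv_sqLaw_Iic_le_add`): the
derivative in the variance is a density weighted by `z ^ 2`, and this weight is absorbed by doubling
the variance. Removing a mean `b` costs a multiple of `M * b ^ 2` (`abs_conv_sqLaw_shift_sub_le`):
raising the variance by `b ^ 2` is the same as a random Gaussian shift, which by Anderson's
inequality does at least a fixed fraction of the damage of the shift `b`. Translating the argument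
by `r` costs `M * r`.

To compare two spectra, both are raised to their pointwise maximum (`abs_quadLaw_sub_quadLaw_le`).
Each half of this path lies above one of the spectra and uses only the rate of that spectrum, and
the total rise is the `ℓ¹` distance. This is why the sum of the two values of `kappa` appears.

The rate itself is of order `(Λ₁ Λ₂)^{-1/2}` (`hasRate_quadLaw`). If no coefficient dominates, the
characteristic function decays like `|t|^{-3/2}`, as for three equal coefficients; if only the first
dominates, its factor `|t|^{-1/2}` is split off; if the first two dominate, their joint planar
density is bounded directly. Finally `(Λ₁ Λ₂)^{-1/2}` is at most `2 * kappa` (`ofReal_density_le`).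
-/

/-- The law of the square of a real Gaussian variable with mean `b` and variance `c`. -/
def sqLaw (c : ℝ≥0) (b : ℝ) : Measure ℝ := (gaussianReal b c).map (fun x => x ^ 2)

instance (c : ℝ≥0) (b : ℝ) : IsProbabilityMeasure (sqLaw c b) :=
  Measure.isProbabilityMeasure_map (by fun_prop)

/-! ### Concentration rates and convolutions with squared Gaussians -/

/-- The measure `μ` has concentration rate at most `M`: an interval of length `l` has measure at
most `M * l`. -/
def HasRate (μ : Measure ℝ) (M : ℝ) : Prop :=
  ∀ x y : ℝ, μ (Ioc x y) ≤ ENNReal.ofReal (M * (y - x))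

lemma conv_apply (R ν : Measure ℝ) [SFinite ν] {A : Set ℝ} (hA : MeasurableSet A) :
    (R ∗ ν) A = ∫⁻ r, ν {v | r + v ∈ A} ∂(R) := by
  rw [← lintegral_indicator_one hA, Measure.lintegral_conv (measurable_one.indicator hA)]
  refine lintegral_congr fun r => ?_
  rw [← lintegral_indicator_one (by measurability)]
  rfl

/-- Conditioning on the independent summand only translates the interval. -/
lemma HasRate.conv_right {ν : Measure ℝ} [SFinite ν] {M : ℝ} (h : HasRate ν M) (R : Measure ℝ)
    [IsProbabilityMeasure R] : HasRate (R ∗ ν) M := by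
  intro x y
  rw [conv_apply _ _ measurableSet_Ioc]
  calc ∫⁻ r, ν {v | r + v ∈ Ioc x y} ∂(R) ≤ ∫⁻ _, ENNReal.ofReal (M * (y - x)) ∂(R) := by
        refine lintegral_mono fun r => ?_
        have : {v | r + v ∈ Ioc x y} = Ioc (x - r) (y - r) := by
          ext v; simp only [mem_ofPred_eq, mem_Ioc]; constructor <;> rintro ⟨h1, h2⟩ <;>
            constructor <;> linarith
        rw [this]
        exact (h _ _).trans_eq (by ring_nf)
    _ = _ := by simp

lemma HasRate.conv_left {ν : Measure ℝ} [SFinite ν] {M : ℝ} (h : HasRate ν M) (R : Measure ℝ)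
    [IsProbabilityMeasure R] : HasRate (ν ∗ R) M := by
  rw [Measure.conv_comm]; exact h.conv_right R

lemma HasRate.mono {ν : Measure ℝ} {M M' : ℝ} (h : HasRate ν M) (hM : M ≤ M') : HasRate ν M' := by
  intro x y
  rcases le_total x y with hxy | hxy
  · exact (h x y).trans (ENNReal.ofReal_le_ofReal (by gcongr))
  · simp [Ioc_eq_empty_of_le hxy]

lemma gaussianReal_zero_eq_map (c : ℝ≥0) :
    gaussianReal 0 c = (gaussianReal 0 1).map (fun z => √(c : ℝ) * z) := by
  rw [gaussianReal_map_const_mul]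
  congr 1
  · simp
  · ext; simp

lemma sqLaw_zero_eq_map (c : ℝ≥0) :
    sqLaw c 0 = (gaussianReal 0 1).map (fun z => (c : ℝ) * z ^ 2) := by
  rw [sqLaw, gaussianReal_zero_eq_map, Measure.map_map (by fun_prop) (by fun_prop)]
  congr 1
  ext z
  simp [mul_pow]

lemma conv_sqLaw_zero_apply (R : Measure ℝ) [SFinite R] (c : ℝ≥0) {A : Set ℝ}
    (hA : MeasurableSet A) :
    (R ∗ sqLaw c 0) A = (R.prod (gaussianReal 0 1)) {w | w.1 + c * w.2 ^ 2 ∈ A} := by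
  rw [conv_apply _ _ hA, Measure.prod_apply (by measurability), sqLaw_zero_eq_map]
  refine lintegral_congr fun r => ?_
  rw [Measure.map_apply (by fun_prop) (by measurability)]
  rfl

/-! ### Changing the variance of one coordinate -/

/-- Weighting the standard Gaussian by `z ^ 2` is dominated by doubling its variance. -/
lemma lintegral_sq_mul_gaussianReal_le {f : ℝ → ℝ≥0∞} (hf : Measurable f) :
    ∫⁻ z, ENNReal.ofReal (z ^ 2) * f z ∂(gaussianReal 0 1) ≤
      6 * ∫⁻ z, f z ∂(gaussianReal 0 2) := by
  rw [gaussianReal_of_var_ne_zero _ one_ne_zero, gaussianReal_of_var_ne_zero _ two_ne_zero,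
    lintegral_withDensity_eq_lintegral_mul _ (measurable_gaussianPDF _ _) (by fun_prop),
    lintegral_withDensity_eq_lintegral_mul _ (measurable_gaussianPDF _ _) hf,
    ← lintegral_const_mul _ ((measurable_gaussianPDF _ _).mul hf)]
  refine lintegral_mono fun z => ?_
  simp only [Pi.mul_apply]
  rw [← mul_assoc, ← mul_assoc]
  refine mul_le_mul' ?_ le_rfl
  simp only [gaussianPDF_def]
  rw [← ENNReal.ofReal_mul (gaussianPDFReal_nonneg _ _ _),
    show (6 : ℝ≥0∞) = ENNReal.ofReal 6 by simp, ← ENNReal.ofReal_mul (by norm_num)]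
  apply ENNReal.ofReal_le_ofReal
  rw [gaussianPDFReal, gaussianPDFReal]
  have h1 : Real.exp (-(z - 0) ^ 2 / (2 * ((1 : ℝ≥0) : ℝ))) =
      Real.exp (-(z ^ 2 / 4)) * Real.exp (-(z ^ 2 / 4)) := by
    rw [← Real.exp_add]; congr 1; push_cast; ring
  have h2 : Real.exp (-(z - 0) ^ 2 / (2 * ((2 : ℝ≥0) : ℝ))) = Real.exp (-(z ^ 2 / 4)) := by
    congr 1; push_cast; ring
  rw [h1, h2]
  -- Half of the standard exponent is spent on `z ^ 2`; the other half is the exponent of variance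
  -- `2`. The constant is `6 = 3 / 2 * 4`, with `√2 ≤ 3 / 2` coming from the normalizations.
  have h3 : z ^ 2 * Real.exp (-(z ^ 2 / 4)) ≤ 4 := by
    have := Real.add_one_le_exp (z ^ 2 / 4)
    rw [Real.exp_neg, ← div_eq_mul_inv, div_le_iff₀ (Real.exp_pos _)]
    linarith
  have h4 : (√(2 * Real.pi * ((1 : ℝ≥0) : ℝ)))⁻¹ = √2 * (√(2 * Real.pi * ((2 : ℝ≥0) : ℝ)))⁻¹ := by
    have : √(2 * Real.pi * ((2 : ℝ≥0) : ℝ)) = √2 * √(2 * Real.pi * ((1 : ℝ≥0) : ℝ)) := by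
      rw [← Real.sqrt_mul (by norm_num)]; congr 1; push_cast; ring
    rw [this, mul_inv, mul_inv_cancel_left₀ (by positivity)]
  rw [h4]
  have h5 : √2 ≤ 3 / 2 := by rw [Real.sqrt_le_left (by norm_num)]; norm_num
  calc √2 * (√(2 * Real.pi * ((2 : ℝ≥0) : ℝ)))⁻¹ *
        (Real.exp (-(z ^ 2 / 4)) * Real.exp (-(z ^ 2 / 4))) * z ^ 2
      = √2 * (z ^ 2 * Real.exp (-(z ^ 2 / 4))) *
        ((√(2 * Real.pi * ((2 : ℝ≥0) : ℝ)))⁻¹ * Real.exp (-(z ^ 2 / 4))) := by ring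
    _ ≤ 3 / 2 * 4 * ((√(2 * Real.pi * ((2 : ℝ≥0) : ℝ)))⁻¹ * Real.exp (-(z ^ 2 / 4))) := by
        gcongr
    _ = _ := by ring

/-- The left side controls the derivative of the law of `R + s Z²` in `s`. A Gaussian of variance
`2` in place of `Z` turns `s` into `2 * s`. -/
lemma lintegral_sq_mul_indicator_le (R : Measure ℝ) [IsProbabilityMeasure R] (s : ℝ≥0) {A : Set ℝ}
    (hA : MeasurableSet A) :
    ∫⁻ w, ENNReal.ofReal (w.2 ^ 2) * A.indicator 1 (w.1 + s * w.2 ^ 2)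
      ∂(R.prod (gaussianReal 0 1)) ≤ 6 * (R ∗ sqLaw (2 * s) 0) A := by
  have hm : Measurable (A.indicator (1 : ℝ → ℝ≥0∞)) := measurable_one.indicator hA
  rw [lintegral_prod _ (by fun_prop), conv_apply _ _ hA,
    ← lintegral_const_mul' _ _ (by simp)]
  refine lintegral_mono fun r => ?_
  refine (lintegral_sq_mul_gaussianReal_le (f := fun z => A.indicator 1 (r + s * z ^ 2))
    (by fun_prop)).trans_eq ?_
  have h1 : MeasurableSet {v | r + v ∈ A} := by measurability
  congr 1
  rw [gaussianReal_zero_eq_map, lintegral_map (by fun_prop) (by fun_prop), sqLaw_zero_eq_map,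
    ← lintegral_indicator_one h1,
    lintegral_map (measurable_one.indicator h1) (by fun_prop)]
  refine lintegral_congr fun z => ?_
  have : r + (s : ℝ) * (√((2 : ℝ≥0) : ℝ) * z) ^ 2 = r + ((2 * s : ℝ≥0) : ℝ) * z ^ 2 := by
    rw [mul_pow, Real.sq_sqrt (by positivity)]; push_cast; ring
  simp only [this]
  rfl

/-- As `s` runs from `l` to `m`, the point `r + s * z ^ 2` crosses the whole window `(x, x + ε]` at
speed `z ^ 2`; speed times the time spent there is `ε`. -/
lemma ofReal_le_lintegral_sq_mul_indicator {r z x ε l m : ℝ} (hε : 0 < ε) (h1 : r + l * z ^ 2 ≤ x)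
    (h2 : x + ε < r + m * z ^ 2) :
    ENNReal.ofReal ε ≤ ∫⁻ s in Ioc l m,
      ENNReal.ofReal (z ^ 2) * (Ioc x (x + ε)).indicator 1 (r + s * z ^ 2) := by
  have hz : 0 < z ^ 2 := by
    rcases (sq_nonneg z).eq_or_lt with h | h
    · rw [← h] at h1 h2; linarith
    · exact h
  have hsub : Ioc ((x - r) / z ^ 2) ((x + ε - r) / z ^ 2) ⊆ Ioc l m := by
    apply Ioc_subset_Ioc
    · rw [le_div_iff₀ hz]; linarith
    · rw [div_le_iff₀ hz]; linarith
  calc ENNReal.ofReal ε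
      = ∫⁻ s in Ioc ((x - r) / z ^ 2) ((x + ε - r) / z ^ 2), ENNReal.ofReal (z ^ 2) := by
        rw [setLIntegral_const, Real.volume_Ioc, ← ENNReal.ofReal_mul hz.le]
        congr 1; rw [← sub_div, mul_div_cancel₀ _ hz.ne']; ring
    _ = ∫⁻ s in Ioc ((x - r) / z ^ 2) ((x + ε - r) / z ^ 2),
          ENNReal.ofReal (z ^ 2) * (Ioc x (x + ε)).indicator 1 (r + s * z ^ 2) := by
        refine setLIntegral_congr_fun measurableSet_Ioc fun s hs => ?_
        rw [mem_Ioc, div_lt_iff₀ hz, le_div_iff₀ hz] at hs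
        have : r + s * z ^ 2 ∈ Ioc x (x + ε) := ⟨by linarith [hs.1], by linarith [hs.2]⟩
        simp [indicator_of_mem this]
    _ ≤ _ := lintegral_mono_set hsub

/-- Increasing the variance of one coordinate by `m - l` decreases the distribution function by at
most a multiple of `m - l`. -/
lemma conv_sqLaw_Iic_le_add (R : Measure ℝ) [IsProbabilityMeasure R] {l m : ℝ≥0} (hlm : l ≤ m)
    {M : ℝ} (hM : 0 ≤ M) (h : ∀ s, l ≤ s → HasRate (R ∗ sqLaw s 0) M) (x : ℝ) :
    (R ∗ sqLaw l 0) (Iic x) ≤ (R ∗ sqLaw m 0) (Iic x) + ENNReal.ofReal (6 * M * (m - l)) := by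
  have hlm' : (l : ℝ) ≤ m := hlm
  set p := R.prod (gaussianReal 0 1)
  -- A window of width `ε` replaces the derivative. A point with `R + l Z² ≤ x` either stays below
  -- `x + ε` at variance `m`, or crosses the window (the set `D`). The first case costs an extra `M
  -- * ε`, which disappears as `ε → 0`.
  have key : ∀ ε : ℝ≥0, 0 < ε → (R ∗ sqLaw l 0) (Iic x) ≤
      (R ∗ sqLaw m 0) (Iic x) + ENNReal.ofReal (6 * M * (m - l)) + ENNReal.ofReal M * ε := by
    intro ε hε
    have hε' : (0 : ℝ) < ε := hε
    set D : Set (ℝ × ℝ) := {w | w.1 + l * w.2 ^ 2 ≤ x ∧ x + ε < w.1 + m * w.2 ^ 2}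
    have hD : MeasurableSet D := by
      apply MeasurableSet.inter
      · exact measurableSet_le (f := fun w : ℝ × ℝ => w.1 + l * w.2 ^ 2) (by fun_prop)
          measurable_const
      · exact measurableSet_lt (g := fun w : ℝ × ℝ => w.1 + m * w.2 ^ 2) measurable_const
          (by fun_prop)
    have hmeas : Measurable (fun w : (ℝ × ℝ) × ℝ => ENNReal.ofReal (w.1.2 ^ 2) *
        (Ioc x (x + ε)).indicator (1 : ℝ → ℝ≥0∞) (w.1.1 + w.2 * w.1.2 ^ 2)) := by
      have : Measurable ((Ioc x (x + ε)).indicator (1 : ℝ → ℝ≥0∞)) :=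
        measurable_one.indicator measurableSet_Ioc
      fun_prop
    have h1 : ENNReal.ofReal ε * p D ≤ ENNReal.ofReal ε * ENNReal.ofReal (6 * M * (m - l)) :=
      calc ENNReal.ofReal ε * p D = ∫⁻ w in D, ENNReal.ofReal ε ∂p := by
            rw [setLIntegral_const]
        _ ≤ ∫⁻ w in D, (∫⁻ s in Ioc (l : ℝ) m, ENNReal.ofReal (w.2 ^ 2) *
              (Ioc x (x + ε)).indicator 1 (w.1 + s * w.2 ^ 2)) ∂p :=
            setLIntegral_mono' hD fun w hw =>
              ofReal_le_lintegral_sq_mul_indicator hε' hw.1 hw.2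
        _ ≤ ∫⁻ w, (∫⁻ s in Ioc (l : ℝ) m, ENNReal.ofReal (w.2 ^ 2) *
              (Ioc x (x + ε)).indicator 1 (w.1 + s * w.2 ^ 2)) ∂p := setLIntegral_le_lintegral _ _
        _ = ∫⁻ s in Ioc (l : ℝ) m, (∫⁻ w, ENNReal.ofReal (w.2 ^ 2) *
              (Ioc x (x + ε)).indicator 1 (w.1 + s * w.2 ^ 2) ∂p) :=
            lintegral_lintegral_swap hmeas.aemeasurable
        _ ≤ ∫⁻ s in Ioc (l : ℝ) m, ENNReal.ofReal (6 * M * ε) := by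
            refine setLIntegral_mono' measurableSet_Ioc fun s hs => ?_
            have hs0 : 0 ≤ s := l.2.trans hs.1.le
            lift s to ℝ≥0 using hs0
            have hls : l ≤ s := by exact_mod_cast hs.1.le
            refine (lintegral_sq_mul_indicator_le R s measurableSet_Ioc).trans ?_
            calc _ ≤ 6 * ENNReal.ofReal (M * (x + ε - x)) := by
                  gcongr
                  -- The rate is available at `2 * s` because `2 * s ≥ s ≥ l`; only variances above
                  -- `l` are ever used.
                  exact h (2 * s) (hls.trans (by rw [two_mul]; exact le_add_self)) _ _
              _ = _ := by
                  rw [show (6 : ℝ≥0∞) = ENNReal.ofReal 6 by simp,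
                    ← ENNReal.ofReal_mul (by norm_num)]
                  ring_nf
        _ = _ := by
            rw [setLIntegral_const, Real.volume_Ioc, ← ENNReal.ofReal_mul (by positivity),
              ← ENNReal.ofReal_mul (by positivity)]
            ring_nf
    have h2 : p D ≤ ENNReal.ofReal (6 * M * (m - l)) :=
      (ENNReal.mul_le_mul_iff_right (by simpa using hε.ne') (by simp)).1 h1
    have h3 : (R ∗ sqLaw m 0) (Iic (x + ε)) ≤
        (R ∗ sqLaw m 0) (Iic x) + ENNReal.ofReal M * ε := by
      rw [← Iic_union_Ioc_eq_Iic (by linarith : x ≤ x + ε)]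
      refine (measure_union_le _ _).trans (add_le_add le_rfl ((h m hlm _ _).trans_eq ?_))
      rw [add_sub_cancel_left, ENNReal.ofReal_mul hM]; simp
    calc (R ∗ sqLaw l 0) (Iic x) = p {w | w.1 + l * w.2 ^ 2 ∈ Iic x} :=
          conv_sqLaw_zero_apply R l measurableSet_Iic
      _ ≤ p ({w | w.1 + m * w.2 ^ 2 ∈ Iic (x + ε)} ∪ D) := by
          refine measure_mono fun w hw => ?_
          by_cases hw' : w.1 + m * w.2 ^ 2 ≤ x + ε
          · exact Or.inl hw'
          · exact Or.inr ⟨hw, not_le.1 hw'⟩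
      _ ≤ (R ∗ sqLaw m 0) (Iic (x + ε)) + p D := by
          rw [conv_sqLaw_zero_apply R m measurableSet_Iic]
          exact measure_union_le _ _
      _ ≤ ((R ∗ sqLaw m 0) (Iic x) + ENNReal.ofReal M * ε) +
            ENNReal.ofReal (6 * M * (m - l)) := add_le_add h3 h2
      _ = _ := by ring
  refine ENNReal.le_of_forall_pos_le_add fun δ hδ _ => ?_
  have hM1 : (0 : ℝ≥0) < M.toNNReal + 1 := by positivity
  refine (key (δ / (M.toNNReal + 1)) (by positivity)).trans (add_le_add le_rfl ?_)
  rw [ENNReal.ofReal, ← ENNReal.coe_mul, ENNReal.coe_le_coe, ← mul_div_assoc, div_le_iff₀ hM1,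
    mul_comm]
  gcongr
  simp

lemma conv_sqLaw_Iic_antitone (R : Measure ℝ) [IsProbabilityMeasure R] {l m : ℝ≥0} (hlm : l ≤ m)
    (x : ℝ) : (R ∗ sqLaw m 0) (Iic x) ≤ (R ∗ sqLaw l 0) (Iic x) := by
  rw [conv_sqLaw_zero_apply R _ measurableSet_Iic, conv_sqLaw_zero_apply R _ measurableSet_Iic]
  refine measure_mono fun w hw => ?_
  simp only [mem_ofPred_eq, mem_Iic] at hw ⊢
  have : (l : ℝ) * w.2 ^ 2 ≤ m * w.2 ^ 2 := by gcongr
  linarith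

/-! ### Changing the mean of one coordinate -/

lemma sqLaw_neg (c : ℝ≥0) (b : ℝ) : sqLaw c (-b) = sqLaw c b := by
  rw [sqLaw, sqLaw, ← gaussianReal_map_neg, Measure.map_map (by fun_prop) (by fun_prop)]
  congr 1
  ext z
  simp

lemma sqLaw_abs (c : ℝ≥0) (b : ℝ) : sqLaw c |b| = sqLaw c b := by
  rcases abs_choice b with h | h <;> simp [h, sqLaw_neg]

lemma continuous_gaussianPDFReal (m : ℝ) (c : ℝ≥0) : Continuous (gaussianPDFReal m c) := by
  rw [gaussianPDFReal_def]; fun_prop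

/-- The derivative in `b` is the centred density at `-ρ - b` minus that at `ρ - b`, and the second
point is closer to `0`. -/
lemma antitoneOn_integral_gaussianPDFReal (c : ℝ≥0) {ρ : ℝ} (hρ : 0 ≤ ρ) :
    AntitoneOn (fun b => ∫ x in (-ρ)..ρ, gaussianPDFReal b c x) (Ici 0) := by
  set φ := gaussianPDFReal 0 c
  have hφ : Continuous φ := continuous_gaussianPDFReal _ _
  set Ψ : ℝ → ℝ := fun u => ∫ x in (0 : ℝ)..u, φ x
  have hΨ : ∀ u, HasDerivAt Ψ (φ u) u := fun u =>
    intervalIntegral.integral_hasDerivAt_right (hφ.intervalIntegrable _ _)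
      (hφ.stronglyMeasurableAtFilter _ _) hφ.continuousAt
  have hG : (fun b => ∫ x in (-ρ)..ρ, gaussianPDFReal b c x) =
      fun b => Ψ (ρ - b) - Ψ (-ρ - b) := by
    ext b
    simp only [Ψ]
    rw [intervalIntegral.integral_interval_sub_left (hφ.intervalIntegrable _ _)
      (hφ.intervalIntegrable _ _), ← intervalIntegral.integral_comp_sub_right]
    refine intervalIntegral.integral_congr fun x _ => ?_
    simp [φ, gaussianPDFReal_sub]
  have hd : ∀ b, HasDerivAt (fun b => Ψ (ρ - b) - Ψ (-ρ - b)) (φ (-ρ - b) - φ (ρ - b)) b := by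
    intro b
    have h1 := (hΨ (ρ - b)).comp_const_sub ρ b
    have h2 := (hΨ (-ρ - b)).comp_const_sub (-ρ) b
    exact (h1.sub h2).congr_deriv (by ring)
  rw [hG]
  refine antitoneOn_of_deriv_nonpos (convex_Ici 0)
    (fun b _ => (hd b).continuousAt.continuousWithinAt)
    (fun b _ => (hd b).differentiableAt.differentiableWithinAt) fun b hb => ?_
  rw [interior_Ici, mem_Ioi] at hb
  rw [(hd b).deriv, sub_nonpos]
  simp only [φ, gaussianPDFReal]
  have : (ρ - b - 0) ^ 2 ≤ (-ρ - b - 0) ^ 2 := by nlinarith [mul_nonneg hρ hb.le]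
  gcongr

/-- The one-dimensional case of Anderson's inequality. -/
lemma sqLaw_Iic_antitone (c : ℝ≥0) {b b' : ℝ} (h : |b| ≤ |b'|) (y : ℝ) :
    sqLaw c b' (Iic y) ≤ sqLaw c b (Iic y) := by
  rw [← sqLaw_abs c b, ← sqLaw_abs c b', sqLaw, sqLaw,
    Measure.map_apply (by fun_prop) measurableSet_Iic,
    Measure.map_apply (by fun_prop) measurableSet_Iic]
  rcases lt_or_ge y 0 with hy | hy
  · have : (fun x : ℝ => x ^ 2) ⁻¹' Iic y = ∅ := by
      ext x; simp only [mem_preimage, mem_Iic, mem_empty_iff_false, iff_false, not_le]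
      nlinarith [sq_nonneg x]
    simp [this]
  have hset : (fun x : ℝ => x ^ 2) ⁻¹' Iic y = Icc (-√y) √y := by
    ext x
    rw [mem_preimage, mem_Iic, mem_Icc, Real.sq_le hy]
  rw [hset]
  rcases eq_or_ne c 0 with rfl | hc
  · rw [gaussianReal_zero_var, gaussianReal_zero_var, Measure.dirac_apply' _ measurableSet_Icc,
      Measure.dirac_apply' _ measurableSet_Icc]
    by_cases hb : |b'| ∈ Icc (-√y) √y
    · have hb' : |b| ∈ Icc (-√y) √y :=
        ⟨(neg_nonpos.2 (Real.sqrt_nonneg y)).trans (abs_nonneg b), h.trans hb.2⟩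
      rw [indicator_of_mem hb, indicator_of_mem hb']
      exact le_rfl
    · simp [indicator_of_notMem hb]
  rw [gaussianReal_apply_eq_integral _ hc, gaussianReal_apply_eq_integral _ hc]
  apply ENNReal.ofReal_le_ofReal
  have h0 : -√y ≤ √y := by linarith [Real.sqrt_nonneg y]
  rw [integral_Icc_eq_integral_Ioc, integral_Icc_eq_integral_Ioc,
    ← intervalIntegral.integral_of_le h0, ← intervalIntegral.integral_of_le h0]
  exact antitoneOn_integral_gaussianPDFReal c (Real.sqrt_nonneg y) (abs_nonneg b) (abs_nonneg b') h

lemma sqLaw_add_apply (c v : ℝ≥0) {A : Set ℝ} (hA : MeasurableSet A) :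
    sqLaw (c + v) 0 A = ∫⁻ g, sqLaw c g A ∂(gaussianReal 0 v) := by
  have h : gaussianReal 0 (c + v) = gaussianReal 0 v ∗ gaussianReal 0 c := by
    rw [gaussianReal_conv_gaussianReal, add_zero, add_comm]
  have hA' : MeasurableSet ((fun x : ℝ => x ^ 2) ⁻¹' A) := hA.preimage (by fun_prop)
  rw [sqLaw, Measure.map_apply (by fun_prop) hA, h, conv_apply _ _ hA']
  refine lintegral_congr fun g => ?_
  have h2 : gaussianReal g c = (gaussianReal 0 c).map (g + ·) := by
    rw [gaussianReal_map_const_add, zero_add]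
  rw [sqLaw, Measure.map_apply (by fun_prop) hA, h2, Measure.map_apply (by fun_prop) hA']
  rfl

/-- The probability that a standard Gaussian variable has absolute value at least one. -/
def gaussianTail : ℝ := (gaussianReal 0 1).real {z | 1 ≤ |z|}

lemma gaussianTail_pos : 0 < gaussianTail := by
  refine ENNReal.toReal_pos (fun h => ?_) (measure_ne_top _ _)
  have h1 := gaussianReal_absolutelyContinuous' 0 (one_ne_zero (α := ℝ≥0)) h
  have h2 : volume (Icc (1 : ℝ) 2) ≤ volume {z : ℝ | 1 ≤ |z|} :=
    measure_mono fun z hz => hz.1.trans (le_abs_self z)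
  rw [h1] at h2
  norm_num [Real.volume_Icc] at h2

/-- Variance `c + b ^ 2` is variance `c` with a random mean `g` of variance `b ^ 2`. With
probability at least `gaussianTail` one has `|g| ≥ |b|`, and then the mean `g` is at least as
harmful as `b`. So the loss caused by the mean `b` is controlled by the loss caused by the extra
variance. -/
lemma sqLaw_mixture_le (c : ℝ≥0) (b y : ℝ) :
    gaussianTail * (sqLaw c 0).real (Iic y) ≤ gaussianTail * (sqLaw c b).real (Iic y) +
      ((sqLaw c 0).real (Iic y) - (sqLaw (c + Real.toNNReal (b ^ 2)) 0).real (Iic y)) := by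
  set v := Real.toNNReal (b ^ 2)
  set T : Set ℝ := {g | |b| ≤ |g|}
  have hT : MeasurableSet T := measurableSet_le (by fun_prop) (by fun_prop)
  set p0 := sqLaw c 0 (Iic y)
  set pb := sqLaw c b (Iic y)
  have hv : gaussianReal 0 v = (gaussianReal 0 1).map (fun z => |b| * z) := by
    rw [gaussianReal_zero_eq_map]
    simp [v, Real.coe_toNNReal _ (sq_nonneg b), Real.sqrt_sq_eq_abs]
  have hq : gaussianTail ≤ (gaussianReal 0 v).real T := by
    rw [hv, map_measureReal_apply (by fun_prop) hT, gaussianTail]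
    refine measureReal_mono fun z (hz : 1 ≤ |z|) => ?_
    simp only [T, mem_preimage, mem_ofPred_eq, abs_mul, abs_abs]
    nlinarith [abs_nonneg b]
  have h1 : sqLaw (c + v) 0 (Iic y) ≤ gaussianReal 0 v T * pb + gaussianReal 0 v Tᶜ * p0 := by
    rw [sqLaw_add_apply _ _ measurableSet_Iic, ← lintegral_add_compl _ hT]
    gcongr
    · calc _ ≤ ∫⁻ g in T, pb ∂(gaussianReal 0 v) :=
            setLIntegral_mono' hT fun g hg => sqLaw_Iic_antitone c hg y
        _ = _ := by rw [setLIntegral_const, mul_comm]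
    · calc _ ≤ ∫⁻ g in Tᶜ, p0 ∂(gaussianReal 0 v) :=
            setLIntegral_mono' hT.compl fun g hg => sqLaw_Iic_antitone c (by simp) y
        _ = _ := by rw [setLIntegral_const, mul_comm]
  have h2 : (sqLaw (c + v) 0).real (Iic y) ≤ (gaussianReal 0 v).real T * (sqLaw c b).real (Iic y) +
      (1 - (gaussianReal 0 v).real T) * (sqLaw c 0).real (Iic y) := by
    rw [← probReal_compl_eq_one_sub hT]
    have := ENNReal.toReal_mono (by finiteness) h1
    rwa [ENNReal.toReal_add (by finiteness) (by finiteness), ENNReal.toReal_mul,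
      ENNReal.toReal_mul] at this
  have h3 : (sqLaw c b).real (Iic y) ≤ (sqLaw c 0).real (Iic y) :=
    ENNReal.toReal_mono (by finiteness) (sqLaw_Iic_antitone c (by simp) y)
  -- By `h3` the bound in `h2` decreases in the mass of `T`, so `gaussianTail` may replace that
  -- mass.
  nlinarith

lemma conv_real_apply (R ν : Measure ℝ) [IsProbabilityMeasure R] [IsProbabilityMeasure ν] (x : ℝ) :
    (R ∗ ν).real (Iic x) = ∫ r, ν.real (Iic (x - r)) ∂(R) := by
  have h : ∀ r, {v | r + v ∈ Iic x} = Iic (x - r) := fun r => by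
    ext v; simp [le_sub_iff_add_le']
  rw [measureReal_def, conv_apply _ _ measurableSet_Iic]
  simp_rw [h]
  rw [integral_eq_lintegral_of_nonneg_ae (by filter_upwards with r; positivity)]
  · simp [measureReal_def]
  · apply Measurable.aestronglyMeasurable
    have : Antitone (fun r => ν.real (Iic (x - r))) := fun r s hrs =>
      measureReal_mono (Iic_subset_Iic.2 (by linarith))
    exact this.measurable

lemma integrable_real_Iic_sub (R ν : Measure ℝ) [IsProbabilityMeasure R] [IsProbabilityMeasure ν]
    (x : ℝ) : Integrable (fun r => ν.real (Iic (x - r))) R := by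
  have : Antitone (fun r => ν.real (Iic (x - r))) := fun r s hrs =>
      measureReal_mono (Iic_subset_Iic.2 (by linarith))
  refine Integrable.of_bound this.measurable.aestronglyMeasurable 1 ?_
  filter_upwards with r
  rw [Real.norm_of_nonneg (by positivity)]
  exact measureReal_le_one

lemma abs_conv_sqLaw_sub_le_of_le (R : Measure ℝ) [IsProbabilityMeasure R] {l m : ℝ≥0}
    (hlm : l ≤ m) {M : ℝ} (hM : 0 ≤ M) (h : ∀ s, l ≤ s → HasRate (R ∗ sqLaw s 0) M) (x : ℝ) :
    |(R ∗ sqLaw l 0).real (Iic x) - (R ∗ sqLaw m 0).real (Iic x)| ≤ 6 * M * (m - l) := by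
  have hlm' : (l : ℝ) ≤ m := hlm
  have h1 := ENNReal.toReal_mono (by finiteness) (conv_sqLaw_Iic_le_add R hlm hM h x)
  rw [ENNReal.toReal_add (by finiteness) (by finiteness),
    ENNReal.toReal_ofReal (mul_nonneg (by positivity) (sub_nonneg.2 hlm'))] at h1
  have h2 := ENNReal.toReal_mono (by finiteness) (conv_sqLaw_Iic_antitone R hlm x)
  simp only [← measureReal_def] at h1 h2
  rw [abs_of_nonneg (sub_nonneg.2 h2)]
  linarith

/-- Shifting one coordinate by `b` changes the distribution function by at most a multiple
of `b ^ 2`. -/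
lemma abs_conv_sqLaw_shift_sub_le (R : Measure ℝ) [IsProbabilityMeasure R] {c : ℝ≥0} (b : ℝ)
    {M : ℝ} (hM : 0 ≤ M) (h : ∀ s, c ≤ s → HasRate (R ∗ sqLaw s 0) M) (x : ℝ) :
    |(R ∗ sqLaw c b).real (Iic x) - (R ∗ sqLaw c 0).real (Iic x)| ≤
      6 / gaussianTail * M * b ^ 2 := by
  have hq := gaussianTail_pos
  have h1 := abs_conv_sqLaw_sub_le_of_le R
    (le_self_add : c ≤ c + Real.toNNReal (b ^ 2)) hM h x
  push_cast at h1
  rw [Real.coe_toNNReal _ (sq_nonneg b), add_sub_cancel_left] at h1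
  have h1 := (le_abs_self _).trans h1
  have i0 := integrable_real_Iic_sub R (sqLaw c 0) x
  have ib := integrable_real_Iic_sub R (sqLaw c b) x
  have iv := integrable_real_Iic_sub R (sqLaw (c + Real.toNNReal (b ^ 2)) 0) x
  have h2 := integral_mono (i0.const_mul gaussianTail)
    ((ib.const_mul gaussianTail).add (i0.sub iv))
    fun r => sqLaw_mixture_le c b (x - r)
  rw [integral_add' (ib.const_mul _) (i0.sub iv), integral_const_mul, integral_const_mul,
    integral_sub' i0 iv, ← conv_real_apply, ← conv_real_apply, ← conv_real_apply] at h2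
  have h3 : (R ∗ sqLaw c b).real (Iic x) ≤ (R ∗ sqLaw c 0).real (Iic x) := by
    rw [conv_real_apply, conv_real_apply]
    exact integral_mono ib i0 fun r =>
      ENNReal.toReal_mono (by finiteness) (sqLaw_Iic_antitone c (by simp) _)
  rw [abs_sub_comm, abs_of_nonneg (by linarith), div_mul_eq_mul_div, div_mul_eq_mul_div,
    le_div_iff₀ hq]
  linarith

/-! ### Exchanging the coordinates of finite quadratic forms -/

/-- The law of `∑ j < n, X j ^ 2` for independent Gaussian `X j` with mean `b j` and
variance `c j`. -/
def quadLaw (c : ℕ → ℝ≥0) (b : ℕ → ℝ) : ℕ → Measure ℝ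
  | 0 => Measure.dirac 0
  | n + 1 => quadLaw c b n ∗ sqLaw (c n) (b n)

instance (c : ℕ → ℝ≥0) (b : ℕ → ℝ) (n : ℕ) : IsProbabilityMeasure (quadLaw c b n) := by
  induction n with
  | zero => rw [quadLaw]; infer_instance
  | succ n ih => rw [quadLaw]; infer_instance

lemma quadLaw_congr {c c' : ℕ → ℝ≥0} {b b' : ℕ → ℝ} {n : ℕ} (hc : ∀ j < n, c j = c' j)
    (hb : ∀ j < n, b j = b' j) : quadLaw c b n = quadLaw c' b' n := by
  induction n with
  | zero => rfl
  | succ n ih =>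
    rw [quadLaw, quadLaw, ih (fun j hj => hc j (by omega)) (fun j hj => hb j (by omega)),
      hc n (by omega), hb n (by omega)]

lemma quadLaw_update (c : ℕ → ℝ≥0) (b : ℕ → ℝ) (n : ℕ) (s : ℝ≥0) (t : ℝ) :
    quadLaw (Function.update c n s) (Function.update b n t) (n + 1) =
      quadLaw c b n ∗ sqLaw s t := by
  rw [quadLaw, Function.update_self, Function.update_self]
  congr 1
  apply quadLaw_congr <;> intro j hj <;> rw [Function.update_of_ne (by omega)]

/-- Exchanging the coordinates of a quadratic form one by one. -/
lemma abs_quadLaw_sub_le {lam c c' : ℕ → ℝ≥0} {b b' : ℕ → ℝ} {M x : ℝ} {K : ℕ → ℝ}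
    (hc : ∀ j, lam j ≤ c j) (hc' : ∀ j, lam j ≤ c' j) (n : ℕ)
    (step : ∀ j < n, ∀ R : Measure ℝ, IsProbabilityMeasure R →
      (∀ s, lam j ≤ s → HasRate (R ∗ sqLaw s 0) M) →
      |(R ∗ sqLaw (c j) (b j)).real (Iic x) - (R ∗ sqLaw (c' j) (b' j)).real (Iic x)| ≤ K j)
    (R : Measure ℝ) [IsProbabilityMeasure R]
    (hR : ∀ d e, (∀ j, lam j ≤ d j) → HasRate (R ∗ quadLaw d e n) M) :
    |(R ∗ quadLaw c b n).real (Iic x) - (R ∗ quadLaw c' b' n).real (Iic x)| ≤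
      ∑ j ∈ Finset.range n, K j := by
  -- The last coordinate is exchanged first and is then absorbed, in its new form, into `R`. Every
  -- intermediate form has variances at least `lam`, so one rate `M` serves all steps.
  induction n generalizing R with
  | zero => simp [quadLaw]
  | succ n ih =>
    have hupd : ∀ (d : ℕ → ℝ≥0) (s : ℝ≥0), (∀ j, lam j ≤ d j) → lam n ≤ s →
        ∀ j, lam j ≤ Function.update d n s j := by
      intro d s hd hs j
      rcases eq_or_ne j n with rfl | hj
      · simpa using hs
      · simpa [hj] using hd j
    have h1 := step n (by omega) (R ∗ quadLaw c b n) inferInstance fun s hs => by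
      rw [Measure.conv_assoc, ← quadLaw_update c b n s 0]
      exact hR _ _ (hupd c s hc hs)
    have hcomm : ∀ d e, (R ∗ quadLaw d e n) ∗ sqLaw (c' n) (b' n) =
        (R ∗ sqLaw (c' n) (b' n)) ∗ quadLaw d e n := fun d e => by
      rw [Measure.conv_assoc, Measure.conv_comm (quadLaw d e n), ← Measure.conv_assoc]
    have h2 := ih (fun j hj => step j (by omega)) (R ∗ sqLaw (c' n) (b' n)) fun d e hd => by
      rw [← hcomm, Measure.conv_assoc, ← quadLaw_update d e n]
      exact hR _ _ (hupd d _ hd (hc' n))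
    rw [← hcomm, ← hcomm] at h2
    rw [Finset.sum_range_succ, quadLaw, quadLaw, ← Measure.conv_assoc, ← Measure.conv_assoc]
    have := abs_sub_le (((R ∗ quadLaw c b n) ∗ sqLaw (c n) (b n)).real (Iic x))
      (((R ∗ quadLaw c b n) ∗ sqLaw (c' n) (b' n)).real (Iic x))
      (((R ∗ quadLaw c' b' n) ∗ sqLaw (c' n) (b' n)).real (Iic x))
    linarith

lemma abs_quadLaw_shift_sub_le {lam : ℕ → ℝ≥0} {M : ℝ} (hM : 0 ≤ M) (n : ℕ)
    (h : ∀ d e, (∀ j, lam j ≤ d j) → HasRate (quadLaw d e n) M) (b : ℕ → ℝ) (x : ℝ) :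
    |(quadLaw lam b n).real (Iic x) - (quadLaw lam 0 n).real (Iic x)| ≤
      6 / gaussianTail * M * ∑ j ∈ Finset.range n, b j ^ 2 := by
  have := abs_quadLaw_sub_le (c := lam) (c' := lam) (b := b) (b' := 0) (M := M) (x := x)
    (K := fun j => 6 / gaussianTail * M * b j ^ 2) (fun _ => le_rfl) (fun _ => le_rfl) n
    (fun j _ R _ hR => abs_conv_sqLaw_shift_sub_le R (b j) hM hR x) (Measure.dirac 0)
    (fun d e hd => by simpa using h d e hd)
  simpa [← Finset.mul_sum] using this

lemma abs_quadLaw_sub_le_of_le {lam c : ℕ → ℝ≥0} {M : ℝ} (hM : 0 ≤ M) (n : ℕ)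
    (h : ∀ d e, (∀ j, lam j ≤ d j) → HasRate (quadLaw d e n) M) (hc : ∀ j, lam j ≤ c j) (x : ℝ) :
    |(quadLaw lam 0 n).real (Iic x) - (quadLaw c 0 n).real (Iic x)| ≤
      6 * M * ∑ j ∈ Finset.range n, ((c j : ℝ) - lam j) := by
  have := abs_quadLaw_sub_le (c := lam) (c' := c) (b := 0) (b' := 0) (M := M) (x := x)
    (K := fun j => 6 * M * ((c j : ℝ) - lam j)) (fun _ => le_rfl) hc n
    (fun j _ R _ hR => abs_conv_sqLaw_sub_le_of_le R (hc j) hM hR x) (Measure.dirac 0)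
    (fun d e hd => by simpa using h d e hd)
  simpa [← Finset.mul_sum] using this

/-! ### Characteristic functions of quadratic forms -/

lemma norm_charFun_sqLaw_le (c : ℝ≥0) (b t : ℝ) :
    ‖charFun (sqLaw c b) t‖ ≤ (1 + 4 * t ^ 2 * c ^ 2) ^ (-(1 / 4) : ℝ) := by
  rcases eq_or_ne c 0 with rfl | hc
  · simpa using norm_charFun_le_one (μ := sqLaw 0 b) t
  have hc0 : (0 : ℝ) < c := by positivity
  -- The density exponent `-(x - b) ^ 2 / (2 * c)` plus `i t x²` is `B * x ^ 2 + C * x + D`.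
  set B : ℂ := ⟨-(1 / (2 * c)), t⟩ with hB
  set C : ℂ := ((b / c : ℝ) : ℂ) with hC
  set D : ℂ := ((-(b ^ 2 / (2 * c)) : ℝ) : ℂ) with hD
  have hBre : B.re < 0 := by simp [hB, hc0]
  have hB0 : B ≠ 0 := fun h => by simp [h] at hBre
  have hBnorm : 2 * c * ‖B‖ = √(1 + 4 * t ^ 2 * c ^ 2) := by
    have : 1 + 4 * t ^ 2 * (c : ℝ) ^ 2 =
        (2 * c) ^ 2 * (-(1 / (2 * c)) * -(1 / (2 * c)) + t * t) := by
      field_simp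
      ring
    rw [Complex.norm_def, Complex.normSq_mk, this, Real.sqrt_mul (by positivity),
      Real.sqrt_sq (by positivity)]
  have h1 : charFun (sqLaw c b) t =
      ((√(2 * Real.pi * c))⁻¹ : ℝ) * ∫ x : ℝ, Complex.exp (B * x ^ 2 + C * x + D) := by
    rw [charFun_apply_real, sqLaw, integral_map (by fun_prop) (by fun_prop),
      integral_gaussianReal_eq_integral_smul hc, ← integral_const_mul]
    refine integral_congr_ae (ae_of_all _ fun x => ?_)
    simp only [gaussianPDFReal]
    rw [Complex.real_smul, Complex.ofReal_mul, mul_assoc, Complex.ofReal_exp, ← Complex.exp_add]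
    congr 2
    have hB' : B = -(1 / (2 * c)) + t * Complex.I := by
      apply Complex.ext <;> simp [hB]
    rw [hB', hC, hD]
    push_cast
    have : (c : ℂ) ≠ 0 := by exact_mod_cast hc0.ne'
    field_simp
    ring
  -- The mean enters only through this factor, of modulus at most one, so the bound is uniform in
  -- `b`.
  have h2 : ‖Complex.exp (D - C ^ 2 / (4 * B))‖ ≤ 1 := by
    rw [Complex.norm_exp, Real.exp_le_one_iff]
    have : C ^ 2 / (4 * B) = (((b / c) ^ 2 / 4 : ℝ) : ℂ) * B⁻¹ := by
      rw [hC]; push_cast; field_simp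
    rw [this, Complex.sub_re, Complex.re_ofReal_mul, Complex.inv_re, hD, Complex.ofReal_re,
      Complex.normSq_mk]
    have hden : 0 < -(1 / (2 * (c : ℝ))) * -(1 / (2 * (c : ℝ))) + t * t := by
      rw [neg_mul_neg]
      exact add_pos_of_pos_of_nonneg (by positivity) (mul_self_nonneg t)
    have h3 : -(2 * (c : ℝ)) ≤ -(1 / (2 * (c : ℝ))) /
        (-(1 / (2 * (c : ℝ))) * -(1 / (2 * (c : ℝ))) + t * t) := by
      rw [le_div_iff₀ hden]
      have : -(2 * (c : ℝ)) * (-(1 / (2 * (c : ℝ))) * -(1 / (2 * (c : ℝ))) + t * t) =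
        -(1 / (2 * c)) - 2 * c * t ^ 2 := by field_simp; ring
      rw [this]
      nlinarith [mul_nonneg hc0.le (sq_nonneg t)]
    have h4 := mul_le_mul_of_nonneg_left h3 (by positivity : 0 ≤ (b / (c : ℝ)) ^ 2 / 4)
    have h5 : (b / (c : ℝ)) ^ 2 / 4 * -(2 * c) = -(b ^ 2 / (2 * c)) := by field_simp; ring
    simp only [hB] at h4 ⊢
    linarith
  rw [h1, integral_cexp_quadratic hBre, norm_mul, norm_mul]
  have h6 : ‖((Real.pi : ℂ) / -B) ^ (1 / 2 : ℂ)‖ = √(Real.pi / ‖B‖) := by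
    rw [show (1 / 2 : ℂ) = ((1 / 2 : ℝ) : ℂ) by push_cast; rfl, Complex.norm_cpow_real, norm_div,
      norm_neg, Complex.norm_real, Real.norm_of_nonneg Real.pi_pos.le, Real.sqrt_eq_rpow]
  have hBpos : 0 < ‖B‖ := norm_pos_iff.2 hB0
  have h7 : (√(2 * Real.pi * c))⁻¹ * √(Real.pi / ‖B‖) =
      (1 + 4 * t ^ 2 * c ^ 2) ^ (-(1 / 4) : ℝ) := by
    rw [← Real.sqrt_inv, ← Real.sqrt_mul (by positivity)]
    have : (2 * Real.pi * c)⁻¹ * (Real.pi / ‖B‖) = (√(1 + 4 * t ^ 2 * c ^ 2))⁻¹ := by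
      rw [← hBnorm]; field_simp
    rw [this, Real.sqrt_inv, Real.sqrt_eq_rpow, Real.sqrt_eq_rpow, ← Real.rpow_mul (by positivity),
      ← Real.rpow_neg (by positivity)]
    norm_num
  rw [h6, Complex.norm_real, Real.norm_of_nonneg (by positivity), ← mul_assoc, h7]
  exact mul_le_of_le_one_right (by positivity) h2

lemma norm_charFun_quadLaw_le (c : ℕ → ℝ≥0) (b : ℕ → ℝ) (n : ℕ) (t : ℝ) :
    ‖charFun (quadLaw c b n) t‖ ≤
      ∏ j ∈ Finset.range n, (1 + 4 * t ^ 2 * c j ^ 2) ^ (-(1 / 4) : ℝ) := by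
  induction n with
  | zero => simp [quadLaw]
  | succ n ih =>
    rw [quadLaw, charFun_conv, norm_mul, Finset.prod_range_succ]
    gcongr
    exact norm_charFun_sqLaw_le _ _ _

/-! ### Sources of concentration: integrable characteristic functions and planar densities -/

lemma gaussianReal_le_smul_volume (b : ℝ) {c : ℝ≥0} (hc : c ≠ 0) :
    gaussianReal b c ≤ ENNReal.ofReal (√(2 * Real.pi * c))⁻¹ • volume := by
  rw [gaussianReal_of_var_ne_zero _ hc, ← withDensity_const]
  refine withDensity_mono (ae_of_all _ fun x => ENNReal.ofReal_le_ofReal ?_)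
  rw [gaussianPDFReal]
  refine mul_le_of_le_one_right (by positivity) (Real.exp_le_one_iff.2 ?_)
  rw [neg_div]
  exact neg_nonpos.2 (by positivity)

/-- A probability measure whose characteristic function has an integrable majorant `g` has
concentration rate at most `∫ g`. -/
lemma hasRate_of_norm_charFun_le (μ : Measure ℝ) [IsProbabilityMeasure μ] {g : ℝ → ℝ}
    (hg : Integrable g) (hg0 : ∀ t, 0 ≤ g t) (h : ∀ t ≠ 0, ‖charFun μ t‖ ≤ g t) : HasRate μ (∫ t, g t) := by
  intro x y
  rcases le_or_gt y x with hxy | hxy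
  · simp [Ioc_eq_empty_of_le hxy]
  set m := (x + y) / 2
  set ε := (y - x) / 2
  have hε : 0 < ε := by simp only [ε]; linarith
  set γ := gaussianReal 0 1
  have hint0 : 0 ≤ ∫ t, g t := integral_nonneg hg0
  -- The bump `exp (-v ^ 2 / 2)` is the characteristic function of the standard Gaussian, so by
  -- Fubini its integral against `μ` is a Gaussian average of the characteristic function of `μ`.
  have hJ : ((∫ s, Real.exp (-((s - m) / ε) ^ 2 / 2) ∂μ : ℝ) : ℂ) =
      ∫ u, Complex.exp (-(u * m / ε : ℝ) * Complex.I) * charFun μ (u / ε) ∂γ := by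
    calc ((∫ s, Real.exp (-((s - m) / ε) ^ 2 / 2) ∂μ : ℝ) : ℂ)
        = ∫ s, charFun γ ((s - m) / ε) ∂μ := by
          rw [← integral_complex_ofReal]
          refine integral_congr_ae (ae_of_all _ fun s => ?_)
          simp only [γ, charFun_gaussianReal]
          push_cast
          congr 1
          ring
      _ = ∫ s, ∫ u, Complex.exp (((s - m) / ε : ℝ) * u * Complex.I) ∂γ ∂μ := by
          simp_rw [charFun_apply_real]
      _ = ∫ u, ∫ s, Complex.exp (((s - m) / ε : ℝ) * u * Complex.I) ∂μ ∂γ := by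
          refine integral_integral_swap (Integrable.of_bound (C := 1) ?_ ?_)
          · apply Continuous.aestronglyMeasurable
            fun_prop
          · refine ae_of_all _ fun p => ?_
            simp only [Function.uncurry]
            rw [← Complex.ofReal_mul, Complex.norm_exp_ofReal_mul_I]
      _ = _ := by
          refine integral_congr_ae (ae_of_all _ fun u => ?_)
          simp only [charFun_apply_real]
          rw [← integral_const_mul]
          refine integral_congr_ae (ae_of_all _ fun s => ?_)
          simp only
          rw [← Complex.exp_add]
          congr 1
          push_cast
          ring
  set k : ℝ := (√(2 * Real.pi * (1 : ℝ≥0)))⁻¹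
  have hk0 : 0 ≤ k := by positivity
  have hk : k ≤ 1 := by
    refine inv_le_one_of_one_le₀ (Real.one_le_sqrt.2 ?_)
    have := Real.pi_gt_three
    push_cast; linarith
  have hgi : Integrable (fun u => g (u / ε)) (ENNReal.ofReal k • volume) :=
    (hg.comp_div hε.ne').smul_measure (by simp)
  have hle : γ ≤ ENNReal.ofReal k • volume := gaussianReal_le_smul_volume 0 one_ne_zero
  have hJle : ∫ s, Real.exp (-((s - m) / ε) ^ 2 / 2) ∂μ ≤ ε * ∫ t, g t := by
    have hnn : 0 ≤ ∫ s, Real.exp (-((s - m) / ε) ^ 2 / 2) ∂μ :=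
      integral_nonneg fun s => by positivity
    calc ∫ s, Real.exp (-((s - m) / ε) ^ 2 / 2) ∂μ ≤ ∫ u, g (u / ε) ∂γ := by
          rw [← Real.norm_of_nonneg hnn, ← Complex.norm_real, hJ]
          -- The origin is excluded because the majorant `|t| ^ (-1/2) * ...` used later takes the
          -- default value `0` there.
          have hne : ∀ᵐ u ∂γ, u ≠ 0 :=
            (gaussianReal_absolutelyContinuous 0 one_ne_zero).ae_le (Measure.ae_ne volume 0)
          refine norm_integral_le_of_norm_le (hgi.mono_measure hle) (hne.mono fun u hu => ?_)
          rw [norm_mul, ← Complex.ofReal_neg, Complex.norm_exp_ofReal_mul_I, one_mul]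
          exact h _ (div_ne_zero hu hε.ne')
      _ ≤ ∫ u, g (u / ε) ∂(ENNReal.ofReal k • volume) :=
          integral_mono_measure hle (ae_of_all _ fun u => hg0 _) hgi
      _ = k * (ε * ∫ t, g t) := by
          rw [integral_smul_measure, Measure.integral_comp_div, ENNReal.toReal_ofReal hk0,
            abs_of_pos hε, smul_eq_mul, smul_eq_mul]
      _ ≤ _ := mul_le_of_le_one_left (by positivity) hk
  have hlow : Real.exp (-(1 / 2)) * μ.real (Ioc x y) ≤
      ∫ s, Real.exp (-((s - m) / ε) ^ 2 / 2) ∂μ := by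
    have h1 : ∫ s, (Ioc x y).indicator (fun _ => Real.exp (-(1 / 2))) s ∂μ =
        Real.exp (-(1 / 2)) * μ.real (Ioc x y) := by
      rw [integral_indicator_const _ measurableSet_Ioc, smul_eq_mul, mul_comm]
    rw [← h1]
    refine integral_mono ((integrable_const _).indicator measurableSet_Ioc) ?_ fun s => ?_
    · refine Integrable.of_bound (C := 1) (by fun_prop) (ae_of_all _ fun s => ?_)
      rw [Real.norm_of_nonneg (by positivity), Real.exp_le_one_iff, neg_div]
      exact neg_nonpos.2 (by positivity)
    · by_cases hs : s ∈ Ioc x y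
      swap
      · rw [indicator_of_notMem hs]; positivity
      rw [indicator_of_mem hs, Real.exp_le_exp, neg_div, neg_le_neg_iff]
      have : ((s - m) / ε) ^ 2 ≤ 1 := by
        rw [sq_le_one_iff_abs_le_one, abs_div, abs_of_pos hε, div_le_one hε, abs_le]
        simp only [m, ε]
        constructor <;> linarith [hs.1, hs.2]
      linarith
  -- The bump is at least `exp (-1/2) ≥ 1 / 2` on the interval, and this factor `2` cancels against
  -- `y - x = 2 * ε`.
  have he : (1 / 2 : ℝ) ≤ Real.exp (-(1 / 2)) := by
    have := Real.add_one_le_exp (-(1 / 2) : ℝ)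
    linarith
  rw [← ofReal_measureReal]
  apply ENNReal.ofReal_le_ofReal
  have h2 : y - x = 2 * ε := by simp only [ε]; ring
  have h3 : (0 : ℝ) ≤ μ.real (Ioc x y) := measureReal_nonneg
  rw [h2]
  nlinarith

/-- The area of an annulus is `π` times the difference of the squared radii; if `x < 0` the annulus
is a disc. -/
lemma volume_sq_add_sq_le (x y : ℝ) :
    volume {p : ℝ × ℝ | p.1 ^ 2 + p.2 ^ 2 ∈ Ioc x y} ≤ ENNReal.ofReal (Real.pi * (y - x)) := by
  set A : Set (ℝ × ℝ) := {p | p.1 ^ 2 + p.2 ^ 2 ∈ Ioc x y}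
  have hA : MeasurableSet A := by
    have : Measurable (fun p : ℝ × ℝ => p.1 ^ 2 + p.2 ^ 2) := by fun_prop
    exact this measurableSet_Ioc
  have hn : ∀ z : ℂ, z.re ^ 2 + z.im ^ 2 = ‖z‖ ^ 2 := fun z => by
    rw [Complex.sq_norm, Complex.normSq_apply]; ring
  rw [← Complex.volume_preserving_equiv_real_prod.measure_preimage hA.nullMeasurableSet]
  have hball : ∀ r : ℝ, 0 ≤ r → volume (Metric.closedBall (0 : ℂ) √r) =
      ENNReal.ofReal (Real.pi * r) := fun r hr => by
    rw [Complex.volume_closedBall, ← ENNReal.ofReal_pow (Real.sqrt_nonneg r), Real.sq_sqrt hr,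
      mul_comm, ENNReal.ofReal_mul Real.pi_pos.le]
    congr 1
    exact (ENNReal.ofReal_coe_nnreal (p := NNReal.pi)).symm
  rcases lt_or_ge y 0 with hy | hy
  · have : Complex.measurableEquivRealProd ⁻¹' A = ∅ := by
      ext z
      simp only [A, mem_preimage, Complex.measurableEquivRealProd_apply, mem_ofPred_eq, hn, mem_Ioc,
        mem_empty_iff_false, iff_false, not_and, not_le]
      exact fun _ => hy.trans_le (sq_nonneg _)
    simp [this]
  have hsub : Complex.measurableEquivRealProd ⁻¹' A ⊆ Metric.closedBall (0 : ℂ) √y := by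
    intro z hz
    simp only [A, mem_preimage, Complex.measurableEquivRealProd_apply, mem_ofPred_eq, hn] at hz
    rw [mem_closedBall_zero_iff]
    exact Real.le_sqrt_of_sq_le hz.2
  rcases lt_or_ge x 0 with hx | hx
  · refine (measure_mono hsub).trans ?_
    rw [hball y hy]
    apply ENNReal.ofReal_le_ofReal
    nlinarith [Real.pi_pos]
  · rcases le_or_gt y x with hxy | hxy
    · simp [A, Ioc_eq_empty_of_le hxy]
    have hsub' : Complex.measurableEquivRealProd ⁻¹' A ⊆
        Metric.closedBall (0 : ℂ) √y \ Metric.closedBall 0 √x := by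
      refine fun z hz => ⟨hsub hz, ?_⟩
      simp only [A, mem_preimage, Complex.measurableEquivRealProd_apply, mem_ofPred_eq, hn] at hz
      rw [mem_closedBall_zero_iff, not_le, Real.sqrt_lt hx (norm_nonneg z)]
      exact hz.1
    refine (measure_mono hsub').trans ?_
    rw [measure_sdiff (Metric.closedBall_subset_closedBall (Real.sqrt_le_sqrt hxy.le))
      measurableSet_closedBall.nullMeasurableSet (by rw [hball x hx]; simp), hball x hx,
      hball y hy, ← ENNReal.ofReal_sub _ (by positivity)]
    apply ENNReal.ofReal_le_ofReal
    linarith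

/-- The planar density is at most `1 / (2 π √(c c'))`, and the annulus has area at most `π (y - x)`.
Two factors of a characteristic function decay only like `|t|⁻¹`, which is not integrable, so
Fourier inversion would not do here. -/
lemma hasRate_sqLaw_conv_sqLaw {c c' : ℝ≥0} (hc : c ≠ 0) (hc' : c' ≠ 0) (b b' : ℝ) :
    HasRate (sqLaw c b ∗ sqLaw c' b') (1 / (2 * √((c : ℝ) * c'))) := by
  intro x y
  set A : Set (ℝ × ℝ) := {p | p.1 ^ 2 + p.2 ^ 2 ∈ Ioc x y}
  have hA : MeasurableSet A := by
    have : Measurable (fun p : ℝ × ℝ => p.1 ^ 2 + p.2 ^ 2) := by fun_prop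
    exact this measurableSet_Ioc
  set k := (√(2 * Real.pi * c))⁻¹
  set k' := (√(2 * Real.pi * c'))⁻¹
  have hkk : k * k' * Real.pi = 1 / (2 * √((c : ℝ) * c')) := by
    simp only [k, k']
    rw [← mul_inv, ← Real.sqrt_mul (by positivity)]
    have : 2 * Real.pi * (c : ℝ) * (2 * Real.pi * c') = (2 * Real.pi) ^ 2 * (c * c') := by ring
    rw [this, Real.sqrt_mul (by positivity), Real.sqrt_sq (by positivity)]
    have : 0 < √((c : ℝ) * c') := by positivity
    field_simp
  have h1 : (sqLaw c b ∗ sqLaw c' b') (Ioc x y) =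
      ((gaussianReal b c).prod (gaussianReal b' c')) A := by
    rw [Measure.conv, sqLaw, sqLaw, Measure.map_prod_map _ _ (by fun_prop) (by fun_prop),
      Measure.map_map (by fun_prop) (by fun_prop),
      Measure.map_apply (by fun_prop) measurableSet_Ioc]
    rfl
  rw [h1]
  calc ((gaussianReal b c).prod (gaussianReal b' c')) A
      ≤ ((ENNReal.ofReal k • volume).prod (ENNReal.ofReal k' • (volume : Measure ℝ))) A :=
        Measure.prod_mono (gaussianReal_le_smul_volume b hc)
          (gaussianReal_le_smul_volume b' hc') _
    _ = ENNReal.ofReal k * (ENNReal.ofReal k' * volume A) := by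
        rw [Measure.prod_smul_left, Measure.prod_smul_right, Measure.smul_apply,
          Measure.smul_apply, smul_eq_mul, smul_eq_mul]
        rfl
    _ ≤ ENNReal.ofReal k * (ENNReal.ofReal k' * ENNReal.ofReal (Real.pi * (y - x))) := by
        gcongr
        exact volume_sq_add_sq_le x y
    _ = _ := by
        rw [← ENNReal.ofReal_mul (by positivity), ← ENNReal.ofReal_mul (by positivity), ← hkk]
        ring_nf

/-! ### Products without a dominant coefficient, and integrable majorants -/

/-- The exponents `3 * f j / S` lie in `[0, 1]` and sum to `3`; Bernoulli's inequality for concave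
powers is applied to each factor. The product is thus at least as large as for three equal
coefficients. -/
lemma one_add_pow_three_le_prod {ι : Type*} (s : Finset ι) {f : ι → ℝ} {u : ℝ} (hu : 0 ≤ u)
    (hf : ∀ j ∈ s, 0 ≤ f j) (h : ∀ j ∈ s, 3 * f j ≤ ∑ i ∈ s, f i) :
    (1 + u * (∑ i ∈ s, f i) / 3) ^ 3 ≤ ∏ j ∈ s, (1 + u * f j) := by
  set S := ∑ i ∈ s, f i
  have hS0 : 0 ≤ S := Finset.sum_nonneg hf
  rcases hS0.eq_or_lt with hS | hS
  · rw [← hS, mul_zero, zero_div, add_zero, one_pow]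
    exact Finset.prod_const_one.symm.trans_le (Finset.prod_le_prod (fun _ _ => zero_le_one)
      fun j hj => le_add_of_nonneg_right (mul_nonneg hu (hf j hj)))
  have hb : 0 < 1 + u * S / 3 := by positivity
  have h1 : ∀ j ∈ s, (1 + u * S / 3) ^ (3 * f j / S) ≤ 1 + u * f j := fun j hj => by
    have := rpow_one_add_le_one_add_mul_self (s := u * S / 3) (p := 3 * f j / S)
      (by linarith) (by have := hf j hj; positivity) (by rw [div_le_one hS]; exact h j hj)
    refine this.trans_eq ?_
    field_simp
  calc (1 + u * S / 3) ^ 3 = ∏ j ∈ s, (1 + u * S / 3) ^ (3 * f j / S) := by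
        have : 3 * S / S = 3 := by field_simp
        rw [← Real.rpow_sum_of_pos hb, ← Finset.sum_div, ← Finset.mul_sum, this]
        norm_cast
    _ ≤ _ := Finset.prod_le_prod (fun j _ => by positivity) h1

lemma prod_rpow_le {ι : Type*} (s : Finset ι) {f : ι → ℝ} {u : ℝ} (hu : 0 ≤ u)
    (hf : ∀ j ∈ s, 0 ≤ f j) (h : ∀ j ∈ s, 3 * f j ≤ ∑ i ∈ s, f i) :
    ∏ j ∈ s, (1 + u * f j) ^ (-(1 / 4) : ℝ) ≤
      (1 + u * (∑ i ∈ s, f i) / 3) ^ (-(3 / 4) : ℝ) := by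
  have hS0 : 0 ≤ ∑ i ∈ s, f i := Finset.sum_nonneg hf
  rw [Real.finsetProd_rpow _ _ fun j hj => by nlinarith [mul_nonneg hu (hf j hj)]]
  refine (Real.rpow_le_rpow_of_nonpos (by positivity) (one_add_pow_three_le_prod s hu hf h)
    (by norm_num)).trans_eq ?_
  rw [← Real.rpow_natCast, ← Real.rpow_mul (by positivity)]
  norm_num

lemma integrable_one_add_sq_rpow : Integrable fun t : ℝ => (1 + t ^ 2) ^ (-(3 / 4) : ℝ) := by
  have := integrable_rpow_neg_one_add_norm_sq (E := ℝ) (μ := volume) (r := 3 / 2)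
    (by norm_num)
  refine this.congr (ae_of_all _ fun t => ?_)
  norm_num

lemma integrable_abs_rpow_mul : Integrable fun t : ℝ =>
    |t| ^ (-(1 / 2) : ℝ) * (1 + t ^ 2) ^ (-(3 / 4) : ℝ) := by
  have h0 : IntervalIntegrable (fun t : ℝ => |t| ^ (-(1 / 2) : ℝ)) volume 0 1 := by
    refine (intervalIntegral.intervalIntegrable_rpow' (r := -(1 / 2)) (by norm_num)).congr ?_
    intro t ht
    rw [uIoc_of_le zero_le_one] at ht
    simp only [abs_of_pos ht.1]
  have h1 : IntervalIntegrable (fun t : ℝ => |t| ^ (-(1 / 2) : ℝ)) volume (-1) 0 := by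
    simpa using ((IntervalIntegrable.iff_comp_neg (by simp)).1 h0).symm
  have h2 : IntegrableOn (fun t : ℝ => |t| ^ (-(1 / 2) : ℝ)) (Ioc (-1) 1) :=
    (intervalIntegrable_iff_integrableOn_Ioc_of_le (by norm_num)).1 (h1.trans h0)
  refine Integrable.mono' ((h2.integrable_indicator measurableSet_Ioc).add
    integrable_one_add_sq_rpow) (Measurable.aestronglyMeasurable (by fun_prop))
    (ae_of_all _ fun t => ?_)
  rw [Real.norm_of_nonneg (by positivity), Pi.add_apply]
  have h3 : (1 + t ^ 2) ^ (-(3 / 4) : ℝ) ≤ 1 :=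
    Real.rpow_le_one_of_one_le_of_nonpos (by nlinarith [sq_nonneg t]) (by norm_num)
  by_cases ht : t ∈ Ioc (-1 : ℝ) 1
  · rw [indicator_of_mem ht]
    have h4 := mul_le_of_le_one_right (by positivity : 0 ≤ |t| ^ (-(1 / 2) : ℝ)) h3
    have h5 : 0 ≤ (1 + t ^ 2) ^ (-(3 / 4) : ℝ) := by positivity
    linarith
  · rw [indicator_of_notMem ht, zero_add]
    refine mul_le_of_le_one_left (by positivity)
      (Real.rpow_le_one_of_one_le_of_nonpos ?_ (by norm_num))
    by_contra hlt
    rw [not_le, abs_lt] at hlt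
    exact ht ⟨hlt.1, hlt.2.le⟩

/-- The constant in the bound for the concentration rate of a Gaussian quadratic form. -/
def rateConst : ℝ :=
  1 + (∫ t : ℝ, (1 + t ^ 2) ^ (-(3 / 4) : ℝ)) +
    ∫ t : ℝ, |t| ^ (-(1 / 2) : ℝ) * (1 + t ^ 2) ^ (-(3 / 4) : ℝ)

lemma integral_one_add_sq_rpow_le : ∫ t : ℝ, (1 + t ^ 2) ^ (-(3 / 4) : ℝ) ≤ rateConst := by
  have : 0 ≤ ∫ t : ℝ, |t| ^ (-(1 / 2) : ℝ) * (1 + t ^ 2) ^ (-(3 / 4) : ℝ) :=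
    integral_nonneg fun t => by positivity
  rw [rateConst]; linarith

lemma integral_abs_rpow_mul_le :
    ∫ t : ℝ, |t| ^ (-(1 / 2) : ℝ) * (1 + t ^ 2) ^ (-(3 / 4) : ℝ) ≤ rateConst := by
  have : 0 ≤ ∫ t : ℝ, (1 + t ^ 2) ^ (-(3 / 4) : ℝ) := integral_nonneg fun t => by positivity
  rw [rateConst]; linarith

lemma one_le_rateConst : 1 ≤ rateConst := by
  have h1 : 0 ≤ ∫ t : ℝ, (1 + t ^ 2) ^ (-(3 / 4) : ℝ) := integral_nonneg fun t => by positivity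
  have h2 : 0 ≤ ∫ t : ℝ, |t| ^ (-(1 / 2) : ℝ) * (1 + t ^ 2) ^ (-(3 / 4) : ℝ) :=
    integral_nonneg fun t => by positivity
  rw [rateConst]; linarith

/-! ### Concentration rate of a Gaussian quadratic form -/

section Rate

variable {lam c : ℕ → ℝ≥0} {b : ℕ → ℝ} {n : ℕ}

lemma norm_charFun_quadLaw_le_of_le (hc : ∀ j, lam j ≤ c j) (t : ℝ) :
    ‖charFun (quadLaw c b n) t‖ ≤
      ∏ j ∈ Finset.range n, (1 + 4 * t ^ 2 * (lam j : ℝ) ^ 2) ^ (-(1 / 4) : ℝ) := by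
  refine (norm_charFun_quadLaw_le c b n t).trans
    (Finset.prod_le_prod (fun j _ => by positivity) fun j _ => ?_)
  have : (lam j : ℝ) ≤ c j := hc j
  exact Real.rpow_le_rpow_of_nonpos (by positivity) (by gcongr) (by norm_num)

lemma hasRate_quadLaw_of_three_mul_sq_le (hc : ∀ j, lam j ≤ c j)
    (h : ∀ j < n, 3 * (lam j : ℝ) ^ 2 ≤ ∑ i ∈ Finset.range n, (lam i : ℝ) ^ 2)
    (hA : 0 < ∑ i ∈ Finset.range n, (lam i : ℝ) ^ 2) :
    HasRate (quadLaw c b n) (rateConst / √(∑ i ∈ Finset.range n, (lam i : ℝ) ^ 2)) := by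
  set A := ∑ i ∈ Finset.range n, (lam i : ℝ) ^ 2
  set k := √(4 * A / 3)
  have hk : 0 < k := by positivity
  have hk2 : k ^ 2 = 4 * A / 3 := Real.sq_sqrt (by positivity)
  have hint := integrable_one_add_sq_rpow.comp_mul_left' hk.ne'
  refine (hasRate_of_norm_charFun_le (quadLaw c b n) hint (fun t => by positivity)
    fun t _ => ?_).mono ?_
  · refine (norm_charFun_quadLaw_le_of_le hc t).trans ((prod_rpow_le _ (by positivity)
      (fun j _ => by positivity) fun j hj => h j (Finset.mem_range.1 hj)).trans_eq ?_)
    rw [mul_pow, hk2]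
    congr 2
    ring
  · rw [Measure.integral_comp_mul_left (fun t => (1 + t ^ 2) ^ (-(3 / 4) : ℝ)), smul_eq_mul,
      abs_of_pos (by positivity), inv_mul_eq_div]
    gcongr
    · exact zero_le_one.trans one_le_rateConst
    · exact integral_one_add_sq_rpow_le
    · exact Real.sqrt_le_sqrt (by linarith)

lemma hasRate_quadLaw_of_three_mul_tail_sq_le (hc : ∀ j, lam j ≤ c j) (hlam : 0 < lam 0)
    (h : ∀ j < n, 3 * (lam (j + 1) : ℝ) ^ 2 ≤ ∑ i ∈ Finset.range n, (lam (i + 1) : ℝ) ^ 2)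
    (hB : 0 < ∑ i ∈ Finset.range n, (lam (i + 1) : ℝ) ^ 2) :
    HasRate (quadLaw c b (n + 1))
      (rateConst / √(2 * lam 0 * √(∑ i ∈ Finset.range n, (lam (i + 1) : ℝ) ^ 2))) := by
  set B := ∑ i ∈ Finset.range n, (lam (i + 1) : ℝ) ^ 2
  have hl : (0 : ℝ) < lam 0 := hlam
  set k := √(4 * B / 3)
  have hk : 0 < k := by positivity
  have hk2 : k ^ 2 = 4 * B / 3 := Real.sq_sqrt (by positivity)
  -- Chosen so that `D * |k * t| ^ (-1/2) = (2 * lam 0 * |t|) ^ (-1/2)`: the factor of the leading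
  -- coefficient is written in the variable `k * t` of the remaining ones.
  set D := (2 * lam 0 / k) ^ (-(1 / 2) : ℝ)
  have hint := (integrable_abs_rpow_mul.comp_mul_left' hk.ne').const_mul D
  refine (hasRate_of_norm_charFun_le (quadLaw c b (n + 1)) hint (fun t => by positivity)
    fun t ht => ?_).mono ?_
  · refine (norm_charFun_quadLaw_le_of_le hc t).trans ?_
    have ht' : 0 < |t| := abs_pos.2 ht
    have h2 : (1 + 4 * t ^ 2 * (lam 0 : ℝ) ^ 2) ^ (-(1 / 4) : ℝ) ≤
        D * |k * t| ^ (-(1 / 2) : ℝ) := by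
      have e1 : 2 * lam 0 / k * |k * t| = 2 * lam 0 * |t| := by
        rw [abs_mul, abs_of_pos hk]; field_simp
      have e2 : 4 * t ^ 2 * (lam 0 : ℝ) ^ 2 = (2 * lam 0 * |t|) ^ (2 : ℕ) := by
        rw [mul_pow, sq_abs]; ring
      rw [← Real.mul_rpow (by positivity) (by positivity), e1, e2]
      refine (Real.rpow_le_rpow_of_nonpos (x := (2 * lam 0 * |t|) ^ (2 : ℕ)) (by positivity)
        (by linarith) (by norm_num)).trans_eq ?_
      rw [← Real.rpow_natCast, ← Real.rpow_mul (by positivity)]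
      norm_num
    have h3 : ∏ j ∈ Finset.range n, (1 + 4 * t ^ 2 * (lam (j + 1) : ℝ) ^ 2) ^ (-(1 / 4) : ℝ) ≤
        (1 + (k * t) ^ 2) ^ (-(3 / 4) : ℝ) := by
      refine (prod_rpow_le _ (by positivity) (fun j _ => by positivity)
        fun j hj => h j (Finset.mem_range.1 hj)).trans_eq ?_
      rw [mul_pow, hk2]
      congr 2
      ring
    rw [Finset.prod_range_succ']
    calc _ ≤ (1 + (k * t) ^ 2) ^ (-(3 / 4) : ℝ) * (D * |k * t| ^ (-(1 / 2) : ℝ)) := by gcongr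
      _ = _ := by ring
  · rw [integral_const_mul, Measure.integral_comp_mul_left
      (fun t => |t| ^ (-(1 / 2) : ℝ) * (1 + t ^ 2) ^ (-(3 / 4) : ℝ)), smul_eq_mul,
      abs_of_pos (by positivity), ← mul_assoc]
    have hD : D * k⁻¹ = 1 / √(2 * lam 0 * k) := by
      simp only [D]
      rw [Real.rpow_neg (by positivity), ← Real.sqrt_eq_rpow, Real.sqrt_div (by positivity),
        Real.sqrt_mul (by positivity) k]
      have hs : √k * k⁻¹ = (√k)⁻¹ := by
        rw [← div_eq_mul_inv, Real.sqrt_div_self', one_div]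
      rw [inv_div, one_div, mul_inv, div_eq_mul_inv]
      linear_combination (√(2 * lam 0))⁻¹ * hs
    rw [hD, one_div_mul_eq_div]
    gcongr
    · exact zero_le_one.trans one_le_rateConst
    · exact integral_abs_rpow_mul_le
    · exact Real.sqrt_le_sqrt (by linarith)

/-- The first two squares already give the rate, and convolution with the others preserves it. -/
lemma hasRate_quadLaw_of_two (hc : ∀ j, lam j ≤ c j) (h0 : 0 < lam 0) (h1 : 0 < lam 1)
    (hn : 2 ≤ n) : HasRate (quadLaw c b n) (1 / √((lam 0 : ℝ) * lam 1)) := by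
  induction n, hn using Nat.le_induction with
  | base =>
    have h := hasRate_sqLaw_conv_sqLaw (h0.trans_le (hc 0)).ne' (h1.trans_le (hc 1)).ne' (b 0) (b 1)
    simp only [quadLaw, Measure.dirac_zero_conv]
    refine h.mono ?_
    have h0' : (0 : ℝ) < lam 0 := h0
    have h1' : (0 : ℝ) < lam 1 := h1
    have hc0 : (lam 0 : ℝ) ≤ c 0 := hc 0
    have hc1 : (lam 1 : ℝ) ≤ c 1 := hc 1
    have : √((lam 0 : ℝ) * lam 1) ≤ √((c 0 : ℝ) * c 1) := by gcongr
    gcongr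
    linarith [Real.sqrt_nonneg ((c 0 : ℝ) * c 1)]
  | succ n _ ih => exact ih.conv_left _

/-- Concentration of a Gaussian quadratic form whose coefficients dominate a non-increasing
sequence `lam`. -/
lemma hasRate_quadLaw (hlam : Antitone lam) (h1 : 0 < lam 1) (hn : 1 ≤ n)
    (hc : ∀ j, lam j ≤ c j) :
    HasRate (quadLaw c b (n + 1)) (2 * rateConst /
      √(√(∑ i ∈ Finset.range (n + 1), (lam i : ℝ) ^ 2) *
        √(∑ i ∈ Finset.range n, (lam (i + 1) : ℝ) ^ 2))) := by
  have h0 : 0 < lam 0 := h1.trans_le (hlam zero_le_one)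
  have h0' : (0 : ℝ) < lam 0 := h0
  have h1' : (0 : ℝ) < lam 1 := h1
  set A := ∑ i ∈ Finset.range (n + 1), (lam i : ℝ) ^ 2 with hAdef
  set B := ∑ i ∈ Finset.range n, (lam (i + 1) : ℝ) ^ 2 with hBdef
  have hAB : A = B + (lam 0 : ℝ) ^ 2 := Finset.sum_range_succ' _ _
  have hBpos : 0 < B := by
    have : (lam (0 + 1) : ℝ) ^ 2 ≤ B := Finset.single_le_sum
      (f := fun i => (lam (i + 1) : ℝ) ^ 2) (fun i _ => by positivity) (Finset.mem_range.2 hn)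
    exact lt_of_lt_of_le (by positivity) this
  have hApos : 0 < A := by rw [hAB]; positivity
  have hK := one_le_rateConst
  have hmono : ∀ i j, i ≤ j → (lam j : ℝ) ^ 2 ≤ (lam i : ℝ) ^ 2 := fun i j hij => by
    have : (lam j : ℝ) ≤ lam i := hlam hij
    gcongr
  -- These are finite versions of the three cases of `kappa`. In each, the rate is weakened to the
  -- single expression `(Λ₁ Λ₂)^{-1/2}`, which has no case distinction and so passes to the limit in
  -- `n`.
  by_cases hcase1 : 3 * (lam 0 : ℝ) ^ 2 ≤ A
  · refine (hasRate_quadLaw_of_three_mul_sq_le hc (fun j _ => ?_) hApos).mono ?_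
    · have := hmono 0 j (Nat.zero_le _); rw [← hAdef]; linarith
    · rw [← hAdef]
      have : √(√A * √B) ≤ √A := by
        rw [Real.sqrt_le_left (Real.sqrt_nonneg A), sq]
        gcongr
        rw [hAB]; nlinarith [sq_nonneg (lam 0 : ℝ)]
      gcongr
      linarith
  rw [not_le] at hcase1
  have hl0 : √A ≤ 2 * lam 0 := by
    rw [Real.sqrt_le_left (by positivity)]; nlinarith
  by_cases hcase2 : 3 * (lam 1 : ℝ) ^ 2 ≤ B
  · refine (hasRate_quadLaw_of_three_mul_tail_sq_le hc h0 (fun j _ => ?_) hBpos).mono ?_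
    · have := hmono 1 (j + 1) (by omega); rw [← hBdef]; linarith
    · rw [← hBdef]
      have : √(√A * √B) ≤ √(2 * lam 0 * √B) := by gcongr
      gcongr
      linarith
  rw [not_le] at hcase2
  have hl1 : √B ≤ 2 * lam 1 := by
    rw [Real.sqrt_le_left (by positivity)]; nlinarith
  refine (hasRate_quadLaw_of_two hc h0 h1 (by omega)).mono ?_
  have : √(√A * √B) ≤ 2 * √((lam 0 : ℝ) * lam 1) := by
    rw [Real.sqrt_le_left (by positivity), mul_pow, Real.sq_sqrt (by positivity)]
    nlinarith [mul_le_mul hl0 hl1 (Real.sqrt_nonneg B) (by positivity)]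
  rw [div_le_div_iff₀ (by positivity) (by positivity)]
  nlinarith [Real.sqrt_nonneg ((lam 0 : ℝ) * lam 1)]

end Rate

/-! ### Sorting a positive family in non-increasing order -/

/-- The `k`-th largest value (counted from `0`) of the positive family `μ`. -/
def sortedValue {I : Type*} (μ : I → ℝ) (k : ℕ) : ℝ :=
  sSup {t : ℝ | 0 < t ∧ k < {i | t ≤ μ i}.ncard}

/-- Indices are ordered by decreasing `μ`, ties being broken by an arbitrary linear order; `σ i` is
the number of predecessors of `i`, finite because the superlevel sets are. -/
lemma exists_sorting {I : Type*} {μ : I → ℝ} (hpos : ∀ i, 0 < μ i)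
    (hfin : ∀ t, 0 < t → {i | t ≤ μ i}.Finite) :
    ∃ σ : I → ℕ, Function.Injective σ ∧ (∀ i, sortedValue μ (σ i) = μ i) ∧
      ∀ k, k ∉ range σ → sortedValue μ k = 0 := by
  classical
  let _ : LinearOrder I := linearOrderOfSTO WellOrderingRel
  let key : I → ℝᵒᵈ ×ₗ I := fun i => toLex (OrderDual.toDual (μ i), i)
  have hkey : Function.Injective key := fun i j h => by
    have := congrArg (fun p => (ofLex p).2) h
    exact this
  have hle : ∀ i j, key j ≤ key i → μ i ≤ μ j := fun i j h => by
    rcases Prod.Lex.le_iff.1 h with h | h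
    · exact (OrderDual.toDual_lt_toDual.1 h).le
    · exact (OrderDual.toDual.injective h.1).ge
  have hlt : ∀ i j, μ i < μ j → key j < key i := fun i j h =>
    Prod.Lex.lt_iff.2 (Or.inl (OrderDual.toDual_lt_toDual.2 h))
  let pre : I → Set I := fun i => {j | key j < key i}
  have hpre : ∀ i, pre i ⊆ {j | μ i ≤ μ j} := fun i j h => hle i j (le_of_lt h)
  have hprefin : ∀ i, (pre i).Finite := fun i => (hfin _ (hpos i)).subset (hpre i)
  let σ : I → ℕ := fun i => (pre i).ncard
  have hσlt : ∀ i j, key i < key j → σ i < σ j := fun i j h =>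
    ncard_lt_ncard ⟨fun l (hl : key l < key i) => hl.trans h, fun hs => lt_irrefl (key i) (hs h)⟩
      (hprefin j)
  have hσ : Function.Injective σ := fun i j h => by
    by_contra hne
    rcases lt_or_gt_of_ne (hkey.ne hne) with h' | h'
    · exact (hσlt _ _ h').ne h
    · exact (hσlt _ _ h').ne' h
  have hmem : ∀ t, 0 < t → ∀ i, t ≤ μ i → σ i < {j | t ≤ μ j}.ncard := fun t ht i hi =>
    ncard_lt_ncard ⟨fun l hl => hi.trans (hpre i hl), fun hs => lt_irrefl (key i) (hs hi)⟩ (hfin t ht)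
  refine ⟨σ, hσ, fun i => ?_, fun k hk => ?_⟩
  · refine IsGreatest.csSup_eq ⟨⟨hpos i, hmem _ (hpos i) i le_rfl⟩, fun t ht => ?_⟩
    by_contra hlt'
    rw [not_le] at hlt'
    have hsub : {j | t ≤ μ j} ⊆ pre i := fun j hj => hlt i j (hlt'.trans_le hj)
    exact (ncard_le_ncard hsub (hprefin i)).not_gt ht.2
  · have : {t : ℝ | 0 < t ∧ k < {i | t ≤ μ i}.ncard} = ∅ := by
      rw [eq_empty_iff_forall_notMem]
      rintro t ⟨ht, hkt⟩
      set A := (hfin t ht).toFinset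
      have hA : A.card = {i | t ≤ μ i}.ncard := (ncard_eq_toFinset_card _ (hfin t ht)).symm
      -- A superlevel set is carried onto an initial segment of `ℕ`, so a `k` outside the range of
      -- `σ` lies below no such count, and the supremum of the empty set is `0`.
      have himg : A.image σ = Finset.range A.card := by
        refine Finset.eq_of_subset_of_card_le (fun m hm => ?_) ?_
        · obtain ⟨i, hi, rfl⟩ := Finset.mem_image.1 hm
          rw [Finset.mem_range, hA]
          exact hmem t ht i ((hfin t ht).mem_toFinset.1 hi)
        · rw [Finset.card_range, Finset.card_image_of_injective _ hσ]
      have : k ∈ A.image σ := by rw [himg, Finset.mem_range, hA]; exact hkt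
      obtain ⟨i, _, rfl⟩ := Finset.mem_image.1 this
      exact hk (mem_range_self i)
    rw [sortedValue, this, Real.sSup_empty]

lemma sortedValue_nonneg {I : Type*} (μ : I → ℝ) (k : ℕ) : 0 ≤ sortedValue μ k :=
  Real.sSup_nonneg fun _ ht => ht.1.le

lemma sortedValue_antitone {I : Type*} {μ : I → ℝ} {B : ℝ} (hB : ∀ i, μ i ≤ B) :
    Antitone (sortedValue μ) := by
  intro k l hkl
  rcases {t : ℝ | 0 < t ∧ l < {i | t ≤ μ i}.ncard}.eq_empty_or_nonempty with h | h
  · rw [sortedValue, h, Real.sSup_empty]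
    exact sortedValue_nonneg μ k
  · refine csSup_le_csSup ⟨B, fun t ht => ?_⟩ h fun t ht => ⟨ht.1, hkl.trans_lt ht.2⟩
    obtain ⟨i, hi⟩ := nonempty_of_ncard_ne_zero (by have := ht.2; omega : {i | t ≤ μ i}.ncard ≠ 0)
    exact le_trans hi (hB i)

/-! ### Spectral decomposition along the sorted eigenvalues -/

section Spectral

variable {H : Type*} [NormedAddCommGroup H] [InnerProductSpace ℝ H] [CompleteSpace H]

local notation "⟪" x ", " y "⟫" => inner ℝ x y

/-- Diagonalization of a positive compact operator of finite trace along its sorted eigenvalues. -/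
lemma exists_eigenvectors (T : H →L[ℝ] H) (hT : IsCompactOperator T)
    (hpos : T.toLinearMap.IsPositive) {B : ℝ}
    (htr : ∀ (s : Finset H), Orthonormal ℝ (fun x : s => (x : H)) →
      ∑ x ∈ s, ⟪T x, x⟫ ≤ B) :
    Antitone (eigenvalue T) ∧ (∀ k, 0 ≤ eigenvalue T k) ∧ Summable (eigenvalue T) ∧
    ∃ e : ℕ → H, (∀ k, T (e k) = eigenvalue T k • e k) ∧
      (Orthonormal ℝ fun k : {k // eigenvalue T k ≠ 0} => e k) ∧
      (∀ k, eigenvalue T k = 0 → e k = 0) ∧ ∀ x, (∀ k, ⟪e k, x⟫ = 0) → T x = 0 := by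
  classical
  have hsymm : T.toLinearMap.IsSymmetric := hpos.isSymmetric
  have hfd : ∀ s : {s : ℝ // 0 < s},
      FiniteDimensional ℝ (Module.End.eigenspace T.toLinearMap (s : ℝ)) := fun s =>
    ContinuousLinearMap.finite_dimensional_eigenspace hT s s.2.ne'
  let V : {s : ℝ // 0 < s} → Submodule ℝ H := fun s => Module.End.eigenspace T.toLinearMap (s : ℝ)
  let bas : ∀ s, OrthonormalBasis (Fin (Module.finrank ℝ (V s))) ℝ (V s) := fun s =>
    stdOrthonormalBasis ℝ (V s)
  let I := Σ s : {s : ℝ // 0 < s}, Fin (Module.finrank ℝ (V s))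
  let v : I → H := fun i => (bas i.1 i.2 : H)
  let μ : I → ℝ := fun i => i.1
  have hμpos : ∀ i, 0 < μ i := fun i => i.1.2
  have hV : OrthogonalFamily ℝ (fun s => V s) fun s => (V s).subtypeₗᵢ :=
    hsymm.orthogonalFamily_eigenspaces.comp Subtype.val_injective
  have hv : Orthonormal ℝ v := hV.orthonormal_sigma_orthonormal fun s => (bas s).orthonormal
  have hTv : ∀ i, T (v i) = μ i • v i := fun i =>
    Module.End.mem_eigenspace_iff.1 (bas i.1 i.2).2
  have hsum_le : ∀ s : Finset I, ∑ i ∈ s, μ i ≤ B := fun s => by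
    have h1 := htr (s.image v) (by
      have h2 : Orthonormal ℝ (fun x : range v => (x : H)) := hv.toSubtypeRange
      refine h2.comp (fun x : s.image v => ⟨x, ?_⟩) fun x y hxy => ?_
      · obtain ⟨i, _, hi⟩ := Finset.mem_image.1 x.2
        exact ⟨i, hi⟩
      · exact Subtype.ext (congrArg (fun z : range v => (z : H)) hxy))
    rw [Finset.sum_image (fun i _ j _ h => hv.linearIndependent.injective h)] at h1
    refine le_trans (le_of_eq (Finset.sum_congr rfl fun i _ => ?_)) h1
    rw [hTv, real_inner_smul_left, real_inner_self_eq_norm_sq, hv.1 i]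
    simp
  have hμsum : Summable μ := summable_of_sum_le (fun i => (hμpos i).le) hsum_le
  have hμB : ∀ i, μ i ≤ B := fun i => by simpa using hsum_le {i}
  have hfin : ∀ t, 0 < t → {i | t ≤ μ i}.Finite := fun t ht => by
    have := hμsum.tendsto_cofinite_zero.eventually (gt_mem_nhds ht)
    simpa [Filter.eventually_cofinite] using this
  have hspan : ∀ s, Submodule.span ℝ (range fun j => (bas s j : H)) = V s := fun s => by
    have h1 := (bas s).toBasis.span_eq
    have h2 := congrArg (Submodule.map (V s).subtype) h1
    rw [Submodule.map_span, Submodule.map_top, Submodule.range_subtype, ← range_comp] at h2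
    simpa [Function.comp_def] using h2
  -- Above the level `t` the eigenspaces are spanned by the orthonormal vectors `v i` with `t ≤ μ
  -- i`, so the rank in `eigenvalue` counts indices and `eigenvalue T` is `sortedValue μ`.
  have hrank : ∀ t, 0 < t → ∀ k : ℕ, ((k : Cardinal) < Module.rank ℝ
      ↥(⨆ s ∈ Ici t, Module.End.eigenspace T.toLinearMap s)) ↔ k < {i | t ≤ μ i}.ncard := by
    intro t ht k
    have h1 : (⨆ s ∈ Ici t, Module.End.eigenspace T.toLinearMap s) =
        Submodule.span ℝ (v '' {i | t ≤ μ i}) := by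
      apply le_antisymm
      · refine iSup₂_le fun s hs => ?_
        rw [mem_Ici] at hs
        refine (hspan ⟨s, ht.trans_le hs⟩).symm.trans_le (Submodule.span_mono ?_)
        rintro _ ⟨j, rfl⟩
        exact ⟨⟨⟨s, ht.trans_le hs⟩, j⟩, hs, rfl⟩
      · rw [Submodule.span_le]
        rintro _ ⟨i, hi, rfl⟩
        exact Submodule.mem_iSup_of_mem (μ i) (Submodule.mem_iSup_of_mem hi (bas i.1 i.2).2)
    have hli : LinearIndepOn ℝ id (v '' {i | t ≤ μ i}) :=
      (hv.linearIndependent.linearIndepOn_id).mono (image_subset_range _ _)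
    rw [h1, rank_span_set hli, ← Set.cast_ncard ((hfin t ht).image v), Nat.cast_lt,
      ncard_image_of_injective _ hv.linearIndependent.injective]
  have heig : eigenvalue T = sortedValue μ := by
    ext k
    rw [eigenvalue, sortedValue]
    congr 1
    ext t
    exact and_congr_right fun ht => hrank t ht k
  obtain ⟨σ, hσ, hσμ, hσ0⟩ := exists_sorting hμpos hfin
  have hrange : ∀ k, eigenvalue T k ≠ 0 ↔ k ∈ range σ := fun k => by
    rw [heig]
    refine ⟨fun h => by_contra fun h' => h (hσ0 k h'), ?_⟩
    rintro ⟨i, rfl⟩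
    rw [hσμ]; exact (hμpos i).ne'
  refine ⟨heig ▸ sortedValue_antitone hμB, fun k => heig ▸ sortedValue_nonneg μ k, ?_,
    -- Zero vectors fill the places of zero eigenvalues, so that finite and infinite rank are
    -- treated alike.
    Function.extend σ v 0, fun k => ?_, ?_, fun k hk => ?_, fun x hx => ?_⟩
  · rw [heig, ← hσ.summable_iff (fun k hk => hσ0 k hk)]
    exact hμsum.congr fun i => (hσμ i).symm
  · by_cases hk : k ∈ range σ
    · obtain ⟨i, rfl⟩ := hk
      rw [hσ.extend_apply, hTv, heig, hσμ]
    · rw [Function.extend_apply' _ _ _ hk]; simp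
  · choose τ hτ using fun k : {k // eigenvalue T k ≠ 0} => (hrange k).1 k.2
    have h1 : (fun k : {k // eigenvalue T k ≠ 0} => Function.extend σ v 0 (k : ℕ)) = v ∘ τ := by
      ext k
      rw [Function.comp_apply, ← hσ.extend_apply v 0 (τ k), hτ]
    rw [h1]
    refine hv.comp τ fun k l hkl => Subtype.ext ?_
    rw [← hτ k, ← hτ l, hkl]
  · rw [Function.extend_apply' _ _ _ (fun h => (hrange k).2 h hk)]; rfl
  · have hxv : ∀ i, ⟪v i, x⟫ = 0 := fun i => by
      have := hx (σ i)
      rwa [hσ.extend_apply] at this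
    -- By the spectral theorem it is enough that `T x` is orthogonal to every eigenspace. Negative
    -- eigenvalues are excluded by positivity, eigenvalue `0` is trivial, and the positive
    -- eigenspaces are orthogonal to `x`.
    have hperp := ContinuousLinearMap.orthogonalComplement_iSup_eigenspaces_eq_bot hT hsymm
    rw [← Submodule.mem_bot ℝ, ← hperp, Submodule.mem_orthogonal']
    intro w hw
    refine Submodule.iSup_induction _ (motive := fun w => ⟪T x, w⟫ = 0) hw (fun s w hw => ?_)
      (inner_zero_right _) fun w w' h h' => by rw [inner_add_right, h, h', add_zero]
    have hTw : T w = s • w := Module.End.mem_eigenspace_iff.1 hw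
    have h1 : ⟪T x, w⟫ = s * ⟪x, w⟫ := by
      rw [← real_inner_smul_right, ← hTw]; exact hsymm x w
    rw [h1]
    rcases lt_trichotomy s 0 with hs | hs | hs
    · have h2 : 0 ≤ ⟪T w, w⟫ := hpos.2 w
      rw [hTw, real_inner_smul_left] at h2
      have h3 : ⟪w, w⟫ = 0 := le_antisymm (by nlinarith) real_inner_self_nonneg
      rw [inner_self_eq_zero.1 h3]; simp
    · simp [hs]
    · have hw' : w ∈ Submodule.span ℝ (range fun j => (bas ⟨s, hs⟩ j : H)) := by
        rw [hspan]; exact hw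
      have : ⟪x, w⟫ = 0 := by
        refine Submodule.span_induction (p := fun w _ => ⟪x, w⟫ = 0) ?_ (inner_zero_right _)
          (fun w w' _ _ h h' => by rw [inner_add_right, h, h', add_zero])
          (fun c w _ h => by rw [real_inner_smul_right, h, mul_zero]) hw'
        rintro _ ⟨j, rfl⟩
        rw [real_inner_comm]
        exact hxv ⟨⟨s, hs⟩, j⟩
      rw [this, mul_zero]

end Spectral

/-! ### Parseval's identity and compactness of the covariance operator -/

section Covariance

variable {H : Type*} [NormedAddCommGroup H] [InnerProductSpace ℝ H] [CompleteSpace H]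

local notation "⟪" x ", " y "⟫" => inner ℝ x y

/-- Parseval's identity for an orthogonal sequence of unit and zero vectors, with the defect given
by the projection to the orthogonal complement. -/
lemma hasSum_inner_sq {e : ℕ → H} {p : ℕ → Prop} (he : Orthonormal ℝ fun k : {k // p k} => e k)
    (h0 : ∀ k, ¬ p k → e k = 0) (x : H) :
    HasSum (fun k => ⟪e k, x⟫ ^ 2)
      (‖x‖ ^ 2 - ‖(Submodule.span ℝ (range e))ᗮ.starProjection x‖ ^ 2) := by
  -- The nonzero `e k` form a Hilbert basis of the closed span `K`, which has the same orthogonal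
  -- complement as the span; Pythagoras gives the defect.
  let K := (Submodule.span ℝ (range e)).topologicalClosure
  have hK : Kᗮ = (Submodule.span ℝ (range e))ᗮ := Submodule.orthogonal_closure _
  have hmem : ∀ k, e k ∈ K := fun k =>
    Submodule.le_topologicalClosure _ (Submodule.subset_span (mem_range_self k))
  have : CompleteSpace K := (Submodule.isClosed_topologicalClosure _).completeSpace_coe
  let f : {k // p k} → K := fun k => ⟨e k, hmem k⟩
  have hf : Orthonormal ℝ f := he.codRestrict K fun k => hmem k
  have hfbot : (Submodule.span ℝ (range f))ᗮ = ⊥ := by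
    rw [eq_bot_iff]
    intro u hu
    have h1 : ∀ k, ⟪e k, (u : H)⟫ = 0 := fun k => by
      by_cases hk : p k
      · exact (Submodule.mem_orthogonal _ _).1 hu (f ⟨k, hk⟩)
          (Submodule.subset_span (mem_range_self _))
      · rw [h0 k hk, inner_zero_left]
    have h2 : (u : H) ∈ Kᗮ := by
      rw [hK, Submodule.mem_orthogonal]
      intro w hw
      refine Submodule.span_induction (p := fun w _ => ⟪w, (u : H)⟫ = 0) ?_ (inner_zero_left _)
        (fun w w' _ _ h h' => by rw [inner_add_left, h, h', add_zero])
        (fun c w _ h => by rw [real_inner_smul_left, h, mul_zero]) hw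
      rintro _ ⟨k, rfl⟩
      exact h1 k
    have h3 : ⟪(u : H), (u : H)⟫ = 0 := (Submodule.mem_orthogonal _ _).1 h2 _ u.2
    rw [Submodule.mem_bot]
    exact Subtype.ext (inner_self_eq_zero.1 h3)
  let bs := HilbertBasis.mkOfOrthogonalEqBot hf hfbot
  have hbs : ⇑bs = f := HilbertBasis.coe_mkOfOrthogonalEqBot hf hfbot
  have hsum := bs.hasSum_inner_mul_inner (K.orthogonalProjectionOnto x)
    (K.orthogonalProjectionOnto x)
  have hnorm : ‖x‖ ^ 2 - ‖(Submodule.span ℝ (range e))ᗮ.starProjection x‖ ^ 2 =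
      ⟪K.orthogonalProjectionOnto x, K.orthogonalProjectionOnto x⟫ := by
    have := Submodule.norm_sq_eq_add_norm_sq_starProjection x K
    rw [real_inner_self_eq_norm_sq]
    simp only [hK] at this
    rw [this, Submodule.starProjection_apply]
    simp
  rw [hnorm]
  have hsum' : HasSum ((fun k => ⟪e k, x⟫ ^ 2) ∘ ((↑) : {k // p k} → ℕ))
      ⟪K.orthogonalProjectionOnto x, K.orthogonalProjectionOnto x⟫ := by
    have hfun : ((fun k => ⟪e k, x⟫ ^ 2) ∘ ((↑) : {k // p k} → ℕ)) = fun k =>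
        ⟪K.orthogonalProjectionOnto x, bs k⟫ * ⟪bs k, K.orthogonalProjectionOnto x⟫ := by
      funext k
      rw [Function.comp_apply, hbs, real_inner_comm (f k),
        Submodule.inner_orthogonalProjectionOnto_eq_of_mem_left]
      exact sq _
    rw [hfun]
    exact hsum
  refine (hasSum_subtype_iff_of_support_subset (s := {k | p k}) fun k hk => ?_).1 hsum'
  by_contra hpk
  exact hk (by simp [h0 k hpk])

variable [MeasurableSpace H] [BorelSpace H] {μ : Measure H}

/-- Bessel's inequality under the integral: the trace is bounded by the second moment. -/
lemma sum_inner_covarianceOperator_le (hμ : MemLp id 2 μ) (s : Finset H)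
    (hs : Orthonormal ℝ (fun x : s => (x : H))) :
    ∑ x ∈ s, ⟪covarianceOperator μ x, x⟫ ≤ ∫ z, ‖z‖ ^ 2 ∂μ := by
  have hint : ∀ x : H, Integrable (fun z => ⟪x, z⟫ ^ 2) μ := fun x =>
    (hμ.const_inner x).integrable_sq
  calc ∑ x ∈ s, ⟪covarianceOperator μ x, x⟫ = ∫ z, ∑ x ∈ s, ⟪x, z⟫ ^ 2 ∂μ := by
        rw [integral_finsetSum _ fun x _ => hint x]
        refine Finset.sum_congr rfl fun x _ => ?_
        rw [covarianceOperator_inner hμ]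
        simp_rw [sq]
    _ ≤ _ := by
        refine integral_mono (integrable_finsetSum _ fun x _ => hint x)
          ((memLp_two_iff_integrable_sq_norm hμ.1).1 hμ) fun z => ?_
        have := hs.sum_inner_products_le z (s := Finset.univ)
        simp only
        rw [← Finset.sum_attach]
        simpa using this

variable [TopologicalSpace.SeparableSpace H]

/-- With `P_n` the projections onto finite-dimensional spaces exhausting `H`, the finite rank
operators `P_n T` converge to `T` in norm: the error is at most `∫ ‖z‖ * ‖z - P_n z‖`, which tends
to `0` by dominated convergence. -/
lemma isCompactOperator_covarianceOperator [IsProbabilityMeasure μ] (hμ : MemLp id 2 μ) :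
    IsCompactOperator (covarianceOperator μ) := by
  have : Nonempty H := ⟨0⟩
  let U : ℕ → Submodule ℝ H := fun n =>
    Submodule.span ℝ (TopologicalSpace.denseSeq H '' Iio n)
  have hfd : ∀ n, FiniteDimensional ℝ (U n) := fun n =>
    FiniteDimensional.span_of_finite ℝ ((finite_Iio n).image _)
  have hmono : Monotone U := fun m n hmn => 
    Submodule.span_mono (image_mono (Iio_subset_Iio hmn))
  have hdense : ⊤ ≤ (⨆ n, U n).topologicalClosure := by
    intro x _
    have : closure (range (TopologicalSpace.denseSeq H)) ⊆
        ((⨆ n, U n).topologicalClosure : Set H) := by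
      refine closure_mono ?_
      rintro _ ⟨n, rfl⟩
      refine Submodule.mem_iSup_of_mem (n + 1)
        (Submodule.subset_span ⟨n, Nat.lt_succ_self n, rfl⟩)
    exact this ((TopologicalSpace.denseRange_denseSeq H) x)
  have hnorm : Integrable (fun z => ‖z‖ ^ 2) μ := (memLp_two_iff_integrable_sq_norm hμ.1).1 hμ
  have hle : ∀ n z, ‖z - (U n).starProjection z‖ ≤ ‖z‖ := fun n z => by
    rw [← Submodule.starProjection_orthogonal_val]
    exact Submodule.norm_starProjection_apply_le _ _
  have hmeas : ∀ n, AEStronglyMeasurable (fun z => z - (U n).starProjection z) μ := fun n =>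
    (by fun_prop : Continuous fun z => z - (U n).starProjection z).aestronglyMeasurable
  have hprod_meas : ∀ n, AEStronglyMeasurable (fun z => ‖z‖ * ‖z - (U n).starProjection z‖) μ :=
    fun n => (by fun_prop : Continuous
      fun z => ‖z‖ * ‖z - (U n).starProjection z‖).aestronglyMeasurable
  have hprod_le : ∀ n z, ‖‖z‖ * ‖z - (U n).starProjection z‖‖ ≤ ‖z‖ ^ 2 := fun n z => by
    rw [Real.norm_of_nonneg (by positivity), sq]
    gcongr
    exact hle n z
  have hprod_int : ∀ n, Integrable (fun z => ‖z‖ * ‖z - (U n).starProjection z‖) μ := fun n =>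
    hnorm.mono' (hprod_meas n) (ae_of_all _ (hprod_le n))
  have hlim : Tendsto (fun n => ∫ z, ‖z‖ * ‖z - (U n).starProjection z‖ ∂μ) atTop (𝓝 0) := by
    have := tendsto_integral_of_dominated_convergence (μ := μ)
      (F := fun n z => ‖z‖ * ‖z - (U n).starProjection z‖) (f := fun _ => (0 : ℝ))
      (fun z => ‖z‖ ^ 2) hprod_meas hnorm (fun n => ae_of_all _ (hprod_le n))
      (ae_of_all _ fun z => ?_)
    · simpa using this
    · have h1 := Submodule.starProjection_tendsto_self U hmono z hdense
      have h2 : Tendsto (fun n => ‖z‖ * ‖z - (U n).starProjection z‖) atTop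
          (𝓝 (‖z‖ * ‖z - z‖)) := (tendsto_const_nhds.sub h1).norm.const_mul _
      simpa using h2
  have hint : ∀ x : H, Integrable (fun z => ⟪x, z⟫ • z) μ := fun x => by
    refine (hnorm.const_mul ‖x‖).mono' (Continuous.aestronglyMeasurable (by fun_prop))
      (ae_of_all _ fun z => ?_)
    rw [norm_smul, sq, ← mul_assoc]
    gcongr
    exact norm_inner_le_norm x z
  refine isCompactOperator_of_tendsto (l := atTop)
    (F := fun n => (U n).starProjection ∘L covarianceOperator μ) ?_ (Eventually.of_forall fun n => ?_)
  · rw [tendsto_iff_norm_sub_tendsto_zero]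
    refine squeeze_zero (fun _ => norm_nonneg _) (fun n => ?_) hlim
    refine ContinuousLinearMap.opNorm_le_bound _ (integral_nonneg fun z => by positivity)
      fun x => ?_
    have h1 : ((U n).starProjection ∘L covarianceOperator μ - covarianceOperator μ) x =
        ∫ z, ⟪x, z⟫ • ((U n).starProjection z - z) ∂μ := by
      rw [sub_apply, ContinuousLinearMap.comp_apply,
        covarianceOperator_apply hμ, ← ContinuousLinearMap.integral_comp_comm _ (hint x),
        ← integral_sub (ContinuousLinearMap.integrable_comp _ (hint x)) (hint x)]
      refine integral_congr_ae (ae_of_all _ fun z => ?_)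
      simp [smul_sub]
    rw [h1, mul_comm, ← integral_const_mul]
    refine norm_integral_le_of_norm_le ((hprod_int n).const_mul _) (ae_of_all _ fun z => ?_)
    rw [norm_smul, ← mul_assoc, norm_sub_rev]
    gcongr
    exact norm_inner_le_norm x z
  · exact (isCompactOperator_of_locallyCompactSpace_rng (U n).subtypeL).comp_clm
      ((U n).orthogonalProjectionOnto ∘L covarianceOperator μ)

/-! ### From Gaussian measures to quadratic forms -/

variable [IsGaussian μ]

lemma integral_inner_eq_zero (h0 : ∫ z, z ∂μ = 0) (x : H) : ∫ z, ⟪x, z⟫ ∂μ = 0 := by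
  have hi : Integrable (fun z : H => z) μ := IsGaussian.integrable_id
  rw [integral_inner hi x, h0, inner_zero_right]

lemma covariance_inner_inner (h0 : ∫ z, z ∂μ = 0) (x y : H) :
    cov[fun z => ⟪x, z⟫, fun z => ⟪y, z⟫; μ] = ⟪covarianceOperator μ x, y⟫ := by
  have hμ : MemLp id 2 μ := IsGaussian.memLp_two_id
  have hμx : ∀ x : H, MemLp (fun z => ⟪x, z⟫) 2 μ := fun x => hμ.const_inner x
  rw [covariance_eq_sub (hμx x) (hμx y), covarianceOperator_inner hμ,
    integral_inner_eq_zero h0, zero_mul, sub_zero]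
  rfl

lemma hasGaussianLaw_inner (x : H) : HasGaussianLaw (fun z => ⟪x, z⟫) μ :=
  (IsGaussian.hasGaussianLaw_id (μ := μ)).map_fun (innerSL ℝ x)

lemma map_inner_eq_gaussianReal (h0 : ∫ z, z ∂μ = 0) (x : H) :
    μ.map (fun z => ⟪x, z⟫) = gaussianReal 0 (Real.toNNReal ⟪covarianceOperator μ x, x⟫) := by
  rw [(hasGaussianLaw_inner x).map_eq_gaussianReal, integral_inner_eq_zero h0, ← covariance_self (by fun_prop),
    covariance_inner_inner h0]

lemma iIndepFun_inner {e : ℕ → H} (h0 : ∫ z, z ∂μ = 0)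
    (he : ∀ i j, i ≠ j → ⟪covarianceOperator μ (e i), e j⟫ = 0) :
    iIndepFun (fun k z => ⟪e k, z⟫) μ := by
  rw [iIndepFun_iff_finset]
  intro s
  have hG : HasGaussianLaw (fun z (i : s) => ⟪e i, z⟫) μ :=
    (IsGaussian.hasGaussianLaw_id (μ := μ)).map_fun
      (ContinuousLinearMap.pi fun i : s => innerSL ℝ (e i))
  refine hG.iIndepFun_of_covariance_eq_zero fun i j hij => ?_
  rw [covariance_inner_inner h0]
  exact he _ _ fun h => hij (Subtype.ext h)

lemma map_sum_sq_eq_quadLaw {e : ℕ → H} (h0 : ∫ z, z ∂μ = 0)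
    (he : ∀ i j, i ≠ j → ⟪covarianceOperator μ (e i), e j⟫ = 0) (b : ℕ → ℝ) (n : ℕ) :
    μ.map (fun z => ∑ k ∈ Finset.range n, (⟪e k, z⟫ + b k) ^ 2) =
      quadLaw (fun k => Real.toNNReal ⟪covarianceOperator μ (e k), e k⟫) b n := by
  have hind : iIndepFun (fun k z => (⟪e k, z⟫ + b k) ^ 2) μ :=
    (iIndepFun_inner h0 he).comp (fun k t => (t + b k) ^ 2) (fun k => by fun_prop)
  have hm : ∀ k, Measurable fun z => (⟪e k, z⟫ + b k) ^ 2 := fun k => by fun_prop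
  have hlaw : ∀ k, μ.map (fun z => (⟪e k, z⟫ + b k) ^ 2) =
      sqLaw (Real.toNNReal ⟪covarianceOperator μ (e k), e k⟫) (b k) := fun k => by
    have h1 : gaussianReal (b k) (Real.toNNReal ⟪covarianceOperator μ (e k), e k⟫) =
        (μ.map (fun z => ⟪e k, z⟫)).map (· + b k) := by
      rw [map_inner_eq_gaussianReal h0, gaussianReal_map_add_const, zero_add]
    rw [sqLaw, h1, Measure.map_map (by fun_prop) (by fun_prop),
      Measure.map_map (by fun_prop) (by fun_prop)]
    rfl
  induction n with
  | zero => simp [quadLaw]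
  | succ n ih =>
    rw [quadLaw, ← ih, ← hlaw]
    have h1 := hind.indepFun_sum_range_succ hm n
    have h3 : (∑ j ∈ Finset.range n, fun z => (⟪e j, z⟫ + b j) ^ 2) =
        fun z => ∑ j ∈ Finset.range n, (⟪e j, z⟫ + b j) ^ 2 := by
      ext z; simp
    rw [h3] at h1
    have h2 := h1.map_add_eq_map_conv_map (Finset.measurable_sum _ fun k _ => hm k) (hm n)
    rw [← h2]
    congr 1
    ext z
    simp [Finset.sum_range_succ]

/-- The distribution function of `‖z - a‖ ^ 2` under a centred Gaussian measure, as a limit of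
those of finite-dimensional quadratic forms. -/
lemma exists_tendsto_quadLaw (h0 : ∫ z, z ∂μ = 0) (a : H) :
    Antitone (eigenvalue (covarianceOperator μ)) ∧
    (∀ k, 0 ≤ eigenvalue (covarianceOperator μ) k) ∧
    Summable (eigenvalue (covarianceOperator μ)) ∧
    ∃ (b : ℕ → ℝ) (r : ℝ), 0 ≤ r ∧ (∀ n, ∑ k ∈ Finset.range n, b k ^ 2 + r ≤ ‖a‖ ^ 2) ∧
      ∀ y, Tendsto (fun n => (quadLaw (fun k => Real.toNNReal
        (eigenvalue (covarianceOperator μ) k)) b n).real (Iic (y - r))) atTop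
        (𝓝 (μ.real {z | ‖z - a‖ ^ 2 ≤ y})) := by
  set T := covarianceOperator μ with hT
  have hμ : MemLp id 2 μ := IsGaussian.memLp_two_id
  obtain ⟨hanti, hnn, hsum, e, heig, horth, he0, hcompl⟩ := exists_eigenvectors T
    (isCompactOperator_covarianceOperator hμ) isPositive_covarianceOperator
    (sum_inner_covarianceOperator_le hμ)
  refine ⟨hanti, hnn, hsum, ?_⟩
  have hself : ∀ k, ⟪T (e k), e k⟫ = eigenvalue T k := fun k => by
    rw [heig, real_inner_smul_left]
    by_cases hk : eigenvalue T k = 0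
    · rw [hk, zero_mul]
    · rw [real_inner_self_eq_norm_sq, horth.1 ⟨k, hk⟩]; simp
  have hne : ∀ i j, i ≠ j → ⟪T (e i), e j⟫ = 0 := fun i j hij => by
    rw [heig, real_inner_smul_left]
    by_cases hi : eigenvalue T i = 0
    · rw [hi, zero_mul]
    by_cases hj : eigenvalue T j = 0
    · rw [he0 j hj, inner_zero_right, mul_zero]
    have := horth.2 (i := ⟨i, hi⟩) (j := ⟨j, hj⟩) (fun h => hij (congrArg Subtype.val h))
    rw [this, mul_zero]
  set L := (Submodule.span ℝ (range e))ᗮ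
  have hparseval := fun x => hasSum_inner_sq horth
    (fun k hk => he0 k (not_not.1 hk)) x
  -- The covariance vanishes on `L`, so a centred `z` has no component there, and `L` contributes to
  -- `‖z - a‖ ^ 2` only the constant `r`.
  have hproj : (fun z => L.starProjection z) =ᵐ[μ] 0 := by
    refine ae_eq_zero_of_forall_inner (𝕜 := ℝ) fun c => ?_
    have hq : T (L.starProjection c) = 0 := hcompl _ fun k =>
      (Submodule.mem_orthogonal _ _).1 (Submodule.starProjection_apply_mem L c) _
        (Submodule.subset_span (mem_range_self k))
    have h1 : ∫ z, ⟪L.starProjection c, z⟫ * ⟪L.starProjection c, z⟫ ∂μ = 0 := by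
      rw [← covarianceOperator_inner hμ, ← hT, hq, inner_zero_left]
    rw [integral_eq_zero_iff_of_nonneg (fun z => mul_self_nonneg _)
      (by simpa [sq] using (hμ.const_inner (L.starProjection c)).integrable_sq)] at h1
    filter_upwards [h1] with z hz
    rw [← Submodule.inner_starProjection_left_eq_right]
    exact mul_self_eq_zero.1 hz
  set r := ‖L.starProjection a‖ ^ 2
  set b : ℕ → ℝ := fun k => -⟪e k, a⟫
  refine ⟨b, r, by positivity, fun n => ?_, fun y => ?_⟩
  · have h1 := sum_le_hasSum (Finset.range n) (fun k _ => sq_nonneg ⟪e k, a⟫) (hparseval a)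
    have h2 : ∑ k ∈ Finset.range n, b k ^ 2 = ∑ k ∈ Finset.range n, ⟪e k, a⟫ ^ 2 := by
      simp [b]
    rw [h2]
    linarith
  · have hlaw := map_sum_sq_eq_quadLaw h0 hne b
    simp only [← hT, hself] at hlaw
    set S : ℕ → H → ℝ := fun n z => ∑ k ∈ Finset.range n, (⟪e k, z⟫ + b k) ^ 2
    have hSm : ∀ n, Measurable (S n) := fun n => by fun_prop
    have hSmono : ∀ z, Monotone fun n => S n z := fun z m n hmn =>
      Finset.sum_le_sum_of_subset_of_nonneg (Finset.range_subset_range.2 hmn)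
        fun k _ _ => sq_nonneg _
    have hset : ∀ n, (quadLaw (fun k => Real.toNNReal (eigenvalue T k)) b n).real (Iic (y - r)) =
        μ.real {z | S n z ≤ y - r} := fun n => by
      rw [← hlaw n, map_measureReal_apply (hSm n) measurableSet_Iic]
      rfl
    simp_rw [hset]
    -- Since partial sums increase and the inequality is closed, the ball is a decreasing
    -- intersection; convergence therefore holds at every `y`, not only at continuity points.
    have hae : {z | ‖z - a‖ ^ 2 ≤ y} =ᵐ[μ] ⋂ n, {z | S n z ≤ y - r} := by
      filter_upwards [hproj] with z hz
      have h1 := hparseval (z - a)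
      have h2 : ‖L.starProjection (z - a)‖ ^ 2 = r := by
        rw [map_sub, hz]; simp [r]
      rw [h2] at h1
      have h3 : (fun k => ⟪e k, z - a⟫ ^ 2) = fun k => (⟪e k, z⟫ + b k) ^ 2 := by
        ext k; simp only [b, inner_sub_right]; ring
      rw [h3] at h1
      have h4 := h1.tendsto_sum_nat
      refine propext ⟨fun (h : ‖z - a‖ ^ 2 ≤ y) => mem_iInter.2 fun n => ?_, fun h => ?_⟩
      · have h5 := sum_le_hasSum (Finset.range n) (fun k _ => sq_nonneg (⟪e k, z⟫ + b k)) h1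
        simp only [mem_ofPred_eq, S]
        linarith
      · have h5 := le_of_tendsto' h4 fun n => mem_iInter.1 h n
        change ‖z - a‖ ^ 2 ≤ y
        linarith
    rw [measureReal_congr hae]
    have hlim := tendsto_measure_iInter_atTop (μ := μ) (s := fun n => {z | S n z ≤ y - r})
      (fun n => (measurableSet_le (hSm n) measurable_const).nullMeasurableSet)
      (fun m n hmn z (hz : S n z ≤ y - r) => (hSmono z hmn).trans hz) ⟨0, by finiteness⟩
    exact (ENNReal.tendsto_toReal (by finiteness)).comp hlim

end Covariance

/-! ### Comparison of two finite quadratic forms -/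

lemma HasRate.abs_real_Iic_sub_le {μ : Measure ℝ} [IsProbabilityMeasure μ] {M r : ℝ}
    (h : HasRate μ M) (hM : 0 ≤ M) (hr : 0 ≤ r) (y : ℝ) :
    |μ.real (Iic (y - r)) - μ.real (Iic y)| ≤ M * r := by
  have h1 : μ.real (Ioc (y - r) y) ≤ M * r := by
    have := ENNReal.toReal_mono (by finiteness) (h (y - r) y)
    rwa [sub_sub_cancel, ENNReal.toReal_ofReal (by positivity)] at this
  have h2 : μ.real (Iic y) ≤ μ.real (Iic (y - r)) + μ.real (Ioc (y - r) y) := by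
    rw [← Iic_union_Ioc_eq_Iic (by linarith : y - r ≤ y)]
    exact measureReal_union_le _ _
  have h3 : μ.real (Iic (y - r)) ≤ μ.real (Iic y) :=
    measureReal_mono (Iic_subset_Iic.2 (by linarith))
  rw [abs_le]
  constructor <;> linarith

/-- The constant in the comparison of two finite-dimensional quadratic forms. -/
def compConst : ℝ := 6 / gaussianTail + 7

lemma compConst_pos : 0 < compConst := by
  have := gaussianTail_pos
  rw [compConst]; positivity

lemma abs_quadLaw_shift_sub_quadLaw_le {lam c : ℕ → ℝ≥0} {b : ℕ → ℝ} {M r A : ℝ} (hM : 0 ≤ M)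
    (n : ℕ) (h : ∀ d e, (∀ j, lam j ≤ d j) → HasRate (quadLaw d e n) M) (hc : ∀ j, lam j ≤ c j)
    (hr : 0 ≤ r) (hA : ∑ j ∈ Finset.range n, b j ^ 2 + r ≤ A) (y : ℝ) :
    |(quadLaw lam b n).real (Iic (y - r)) - (quadLaw c 0 n).real (Iic y)| ≤
      compConst * M * (∑ j ∈ Finset.range n, ((c j : ℝ) - lam j) + A) := by
  have h1 := abs_quadLaw_shift_sub_le hM n h b (y - r)
  have h2 := (h lam 0 fun _ => le_rfl).abs_real_Iic_sub_le hM hr y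
  have h3 := abs_quadLaw_sub_le_of_le hM n h hc y
  have hb : 0 ≤ ∑ j ∈ Finset.range n, b j ^ 2 := Finset.sum_nonneg fun _ _ => sq_nonneg _
  have hd : 0 ≤ ∑ j ∈ Finset.range n, ((c j : ℝ) - lam j) :=
    Finset.sum_nonneg fun j _ => sub_nonneg.2 (hc j)
  set β := ∑ j ∈ Finset.range n, b j ^ 2
  set δ := ∑ j ∈ Finset.range n, ((c j : ℝ) - lam j)
  have hq : 0 < 6 / gaussianTail := div_pos (by norm_num) gaussianTail_pos
  -- Removing the means, removing the translation and raising the variances have coefficients `6 /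
  -- gaussianTail`, `1` and `6`; `compConst` is their sum.
  have h4 : 6 / gaussianTail * M * β + M * r + 6 * M * δ ≤ compConst * M * (δ + A) := by
    have : compConst * M * (δ + A) - (6 / gaussianTail * M * β + M * r + 6 * M * δ) =
        6 / gaussianTail * (M * δ) + M * δ + compConst * (M * (A - (β + r))) +
          6 / gaussianTail * (M * r) + 7 * (M * β) + 6 * (M * r) := by
      rw [compConst]; ring
    have hA' : 0 ≤ A - (β + r) := sub_nonneg.2 hA
    have := compConst_pos
    have : 0 ≤ 6 / gaussianTail * (M * δ) + M * δ + compConst * (M * (A - (β + r))) +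
          6 / gaussianTail * (M * r) + 7 * (M * β) + 6 * (M * r) := by positivity
    linarith
  have h5 := abs_sub_le ((quadLaw lam b n).real (Iic (y - r)))
    ((quadLaw lam 0 n).real (Iic (y - r))) ((quadLaw c 0 n).real (Iic y))
  have h6 := abs_sub_le ((quadLaw lam 0 n).real (Iic (y - r)))
    ((quadLaw lam 0 n).real (Iic y)) ((quadLaw c 0 n).real (Iic y))
  linarith

/-- Both forms are compared with the centred form of variances `lam ⊔ nu`. It dominates each of
them, so each leg uses its own rate, and each rise is at most `|lam j - nu j|`. -/
lemma abs_quadLaw_sub_quadLaw_le {lam nu : ℕ → ℝ≥0} {b b' : ℕ → ℝ} {M M' r r' A : ℝ}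
    (hM : 0 ≤ M) (hM' : 0 ≤ M') (n : ℕ)
    (h : ∀ d e, (∀ j, lam j ≤ d j) → HasRate (quadLaw d e n) M)
    (h' : ∀ d e, (∀ j, nu j ≤ d j) → HasRate (quadLaw d e n) M')
    (hr : 0 ≤ r) (hA : ∑ j ∈ Finset.range n, b j ^ 2 + r ≤ A)
    (hr' : 0 ≤ r') (hA' : ∑ j ∈ Finset.range n, b' j ^ 2 + r' ≤ A) (y : ℝ) :
    |(quadLaw lam b n).real (Iic (y - r)) - (quadLaw nu b' n).real (Iic (y - r'))| ≤
      compConst * (M + M') * (∑ j ∈ Finset.range n, |(lam j : ℝ) - nu j| + A) := by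
  have h1 := abs_quadLaw_shift_sub_quadLaw_le (c := lam ⊔ nu) hM n h (fun j => le_sup_left) hr hA y
  have h2 := abs_quadLaw_shift_sub_quadLaw_le (c := lam ⊔ nu) hM' n h' (fun j => le_sup_right)
    hr' hA' y
  have hC := compConst_pos
  have h3 : ∑ j ∈ Finset.range n, (((lam ⊔ nu) j : ℝ≥0) - (lam j : ℝ)) ≤
      ∑ j ∈ Finset.range n, |(lam j : ℝ) - nu j| := Finset.sum_le_sum fun j _ => by
    rw [Pi.sup_apply, NNReal.coe_max, sub_le_iff_le_add]
    exact max_le (by linarith [abs_nonneg ((lam j : ℝ) - nu j)])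
      (by linarith [neg_abs_le ((lam j : ℝ) - nu j)])
  have h4 : ∑ j ∈ Finset.range n, (((lam ⊔ nu) j : ℝ≥0) - (nu j : ℝ)) ≤
      ∑ j ∈ Finset.range n, |(lam j : ℝ) - nu j| := Finset.sum_le_sum fun j _ => by
    rw [Pi.sup_apply, NNReal.coe_max, sub_le_iff_le_add]
    exact max_le (by linarith [le_abs_self ((lam j : ℝ) - nu j)])
      (by linarith [abs_nonneg ((lam j : ℝ) - nu j)])
  have h5 := mul_le_mul_of_nonneg_left (add_le_add_left h3 A) (mul_nonneg hC.le hM)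
  have h6 := mul_le_mul_of_nonneg_left (add_le_add_left h4 A) (mul_nonneg hC.le hM')
  rw [abs_sub_comm] at h2
  have h7 := abs_sub_le ((quadLaw lam b n).real (Iic (y - r)))
    ((quadLaw (lam ⊔ nu) 0 n).real (Iic y)) ((quadLaw nu b' n).real (Iic (y - r')))
  have h8 : compConst * (M + M') * (∑ j ∈ Finset.range n, |(lam j : ℝ) - nu j| + A) =
      compConst * M * (∑ j ∈ Finset.range n, |(lam j : ℝ) - nu j| + A) +
      compConst * M' * (∑ j ∈ Finset.range n, |(lam j : ℝ) - nu j| + A) := by ring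
  linarith

/-! ### Passage to infinite sequences -/

/-- `(Λ₁ Λ₂)^{-1/2}` for a sequence of eigenvalues. -/
def density (l : ℕ → ℝ) : ℝ := 1 / √(√(∑' i, l i ^ 2) * √(∑' i, l (i + 1) ^ 2))

lemma density_nonneg (l : ℕ → ℝ) : 0 ≤ density l := by rw [density]; positivity

section Sequence

variable {l : ℕ → ℝ}

lemma summable_sq (hl0 : ∀ k, 0 ≤ l k) (hs : Summable l) : Summable fun k => l k ^ 2 := by
  have h1 : ∀ᶠ k in cofinite, l k ≤ 1 := hs.tendsto_cofinite_zero.eventually (ge_mem_nhds one_pos)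
  refine hs.of_norm_bounded_eventually ?_
  filter_upwards [h1] with k hk
  rw [Real.norm_eq_abs, abs_of_nonneg (sq_nonneg _)]
  nlinarith [hl0 k]

lemma tsum_tail_sq_pos (hl0 : ∀ k, 0 ≤ l k) (hs : Summable l) (h1 : 0 < l 1) :
    0 < ∑' i, l (i + 1) ^ 2 :=
  ((summable_nat_add_iff 1).2 (summable_sq hl0 hs)).tsum_pos (fun _ => sq_nonneg _) 0
    (by simpa using pow_pos h1 2)

lemma tsum_sq_eq (hl0 : ∀ k, 0 ≤ l k) (hs : Summable l) :
    ∑' i, l i ^ 2 = l 0 ^ 2 + ∑' i, l (i + 1) ^ 2 :=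
  (summable_sq hl0 hs).tsum_eq_zero_add

lemma tendsto_rate (hl0 : ∀ k, 0 ≤ l k) (hs : Summable l) (h1 : 0 < l 1) :
    Tendsto (fun n => 2 * rateConst /
      √(√(∑ i ∈ Finset.range (n + 1), ((l i).toNNReal : ℝ) ^ 2) *
        √(∑ i ∈ Finset.range n, ((l (i + 1)).toNNReal : ℝ) ^ 2)))
      atTop (𝓝 (2 * rateConst * density l)) := by
  simp only [Real.coe_toNNReal _ (hl0 _)]
  have hB := tsum_tail_sq_pos hl0 hs h1
  have hA : 0 < ∑' i, l i ^ 2 := by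
    rw [tsum_sq_eq hl0 hs]; positivity
  have hsA := (summable_sq hl0 hs).hasSum.tendsto_sum_nat.comp (tendsto_add_atTop_nat 1)
  have hsB := ((summable_nat_add_iff 1).2 (summable_sq hl0 hs)).hasSum.tendsto_sum_nat
  rw [density, mul_one_div]
  exact tendsto_const_nhds.div (hsA.sqrt.mul hsB.sqrt).sqrt (by positivity)

end Sequence

lemma abs_sub_le_of_tendsto_quadLaw {l m b b' : ℕ → ℝ} {r r' A y F G : ℝ}
    (hl : Antitone l) (hl0 : ∀ k, 0 ≤ l k) (hls : Summable l) (hl1 : 0 < l 1)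
    (hm : Antitone m) (hm0 : ∀ k, 0 ≤ m k) (hms : Summable m) (hm1 : 0 < m 1)
    (hr : 0 ≤ r) (hA : ∀ n, ∑ j ∈ Finset.range n, b j ^ 2 + r ≤ A)
    (hr' : 0 ≤ r') (hA' : ∀ n, ∑ j ∈ Finset.range n, b' j ^ 2 + r' ≤ A)
    (hF : Tendsto (fun n => (quadLaw (fun k => (l k).toNNReal) b n).real (Iic (y - r))) atTop (𝓝 F))
    (hG : Tendsto (fun n => (quadLaw (fun k => (m k).toNNReal) b' n).real (Iic (y - r')))
      atTop (𝓝 G)) :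
    |F - G| ≤ compConst * (2 * rateConst) * (density l + density m) * (∑' j, |l j - m j| + A) := by
  have hsum : Summable fun j => |l j - m j| := (hls.sub hms).abs
  have hR := one_le_rateConst
  have hFG := ((hF.sub hG).comp (tendsto_add_atTop_nat 1)).abs
  have hlim := (((tendsto_rate hl0 hls hl1).add (tendsto_rate hm0 hms hm1)).const_mul
    compConst).mul ((hsum.hasSum.tendsto_sum_nat.comp (tendsto_add_atTop_nat 1)).add_const A)
  have heq : compConst * (2 * rateConst) * (density l + density m) * (∑' j, |l j - m j| + A) =
      compConst * (2 * rateConst * density l + 2 * rateConst * density m) *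
        (∑' j, |l j - m j| + A) := by ring
  rw [heq]
  refine le_of_tendsto_of_tendsto hFG hlim ?_
  -- At least the two leading coordinates must be present among the `n + 1`.
  filter_upwards [eventually_ge_atTop 1] with n hn
  have hl' : Antitone fun k => (l k).toNNReal := fun i j hij => Real.toNNReal_le_toNNReal (hl hij)
  have hm' : Antitone fun k => (m k).toNNReal := fun i j hij => Real.toNNReal_le_toNNReal (hm hij)
  have := abs_quadLaw_sub_quadLaw_le (by positivity) (by positivity) (n + 1)
    (fun d e hd => hasRate_quadLaw hl' (Real.toNNReal_pos.2 hl1) hn hd)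
    (fun d e hd => hasRate_quadLaw hm' (Real.toNNReal_pos.2 hm1) hn hd) hr (hA (n + 1)) hr'
    (hA' (n + 1)) y
  simpa [Real.coe_toNNReal _ (hl0 _), Real.coe_toNNReal _ (hm0 _)] using this

/-! ### Comparison of `density` with `kappa` -/

section Kappa

variable {H : Type*} [NormedAddCommGroup H] [InnerProductSpace ℝ H] {T : H →L[ℝ] H}

lemma tail_eq_ofReal (h0 : ∀ k, 0 ≤ eigenvalue T k) (hs : Summable (eigenvalue T)) (k : ℕ) :
    tailSq T k = ENNReal.ofReal (∑' i, eigenvalue T (i + k) ^ 2) ∧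
    tail T k = ENNReal.ofReal √(∑' i, eigenvalue T (i + k) ^ 2) := by
  have h1 : tailSq T k = ENNReal.ofReal (∑' i, eigenvalue T (i + k) ^ 2) := by
    rw [tailSq, ENNReal.ofReal_tsum_of_nonneg (fun _ => sq_nonneg _)
      ((summable_nat_add_iff k).2 (summable_sq h0 hs))]
    simp_rw [add_comm]
  refine ⟨h1, ?_⟩
  rw [tail, h1, Real.sqrt_eq_rpow, ENNReal.ofReal_rpow_of_nonneg
    (tsum_nonneg fun _ => sq_nonneg _) (by norm_num)]

/-- If `λ₂ = 0`, the first case forces `λ₁ = 0` and inverts `0`, the second has `Λ₂ = 0`, and the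
third cannot occur. -/
lemma eigenvalue_one_pos_of_kappa_ne_top (hanti : Antitone (eigenvalue T))
    (h0 : ∀ k, 0 ≤ eigenvalue T k) (hs : Summable (eigenvalue T)) (hT : kappa T ≠ ∞) :
    0 < eigenvalue T 1 := by
  by_contra hneg
  have h1 : ∀ i, eigenvalue T (i + 1) = 0 := fun i =>
    le_antisymm ((hanti (by lia)).trans (not_lt.1 hneg)) (h0 _)
  obtain ⟨hq0, ht0⟩ := tail_eq_ofReal h0 hs 0
  obtain ⟨hq1, ht1⟩ := tail_eq_ofReal h0 hs 1
  simp only [add_zero, tsum_sq_eq h0 hs, h1] at hq0 ht0 hq1 ht1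
  refine hT ?_
  rw [kappa]
  split_ifs with hc1 hc2
  · rw [hq0] at hc1
    have h3 : (3 : ℝ≥0∞) = ENNReal.ofReal 3 := by simp
    rw [h3, ← ENNReal.ofReal_mul (by norm_num), ENNReal.ofReal_le_ofReal_iff (by simp; positivity)]
      at hc1
    have h4 : eigenvalue T 0 ^ 2 = 0 := by
      simp only [ne_eq, OfNat.ofNat_ne_zero, not_false_eq_true, zero_pow, tsum_zero] at hc1
      nlinarith [sq_nonneg (eigenvalue T 0)]
    rw [ht0, h4]
    simp
  · rw [ht1]
    simp
  · exact absurd (by rw [show eigenvalue T 1 = 0 from h1 0]; simp) hc2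

/-- In the last two cases the denominator of `kappa` comes from a product at most `Λ₁ Λ₂`. In the
first, `λ₁² ≤ Λ₁² / 3` leaves `Λ₂ ≥ Λ₁ / 2`, and this is where the factor `2` is needed. -/
lemma ofReal_density_le (hanti : Antitone (eigenvalue T)) (h0 : ∀ k, 0 ≤ eigenvalue T k)
    (hs : Summable (eigenvalue T)) (h1 : 0 < eigenvalue T 1) :
    ENNReal.ofReal (density (eigenvalue T)) ≤ 2 * kappa T := by
  obtain ⟨hq0, ht0⟩ := tail_eq_ofReal h0 hs 0
  obtain ⟨hq1, ht1⟩ := tail_eq_ofReal h0 hs 1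
  have hB := tsum_tail_sq_pos h0 hs h1
  have hAB := tsum_sq_eq h0 hs
  have hp := h1.trans_le (hanti zero_le_one)
  have h1B : eigenvalue T 1 ^ 2 ≤ ∑' i, eigenvalue T (i + 1) ^ 2 :=
    ((summable_nat_add_iff 1).2 (summable_sq h0 hs)).le_tsum 0 fun _ _ => sq_nonneg _
  rw [density]
  simp only [add_zero] at hq0 ht0
  set A := ∑' i, eigenvalue T i ^ 2
  set B := ∑' i, eigenvalue T (i + 1) ^ 2
  have hA : 0 < A := by rw [hAB]; positivity
  have h0A : eigenvalue T 0 ≤ √A := Real.le_sqrt_of_sq_le (by linarith)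
  have h1B' : eigenvalue T 1 ≤ √B := Real.le_sqrt_of_sq_le h1B
  have h2 : (2 : ℝ≥0∞) = ENNReal.ofReal 2 := by simp
  have h3 : (3 : ℝ≥0∞) = ENNReal.ofReal 3 := by simp
  have hrpow : ∀ x : ℝ, 0 < x → ENNReal.ofReal x ^ (-(1 / 2) : ℝ) = ENNReal.ofReal (1 / √x) :=
    fun x hx => by
      rw [ENNReal.ofReal_rpow_of_pos hx, Real.rpow_neg hx.le, ← Real.sqrt_eq_rpow, one_div]
  have hweak : ∀ x, 0 < x → x ≤ √A * √B →
      ENNReal.ofReal (1 / √(√A * √B)) ≤ 2 * ENNReal.ofReal (1 / √x) := fun x hx hxA => by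
    refine (ENNReal.ofReal_le_ofReal ?_).trans (le_mul_of_one_le_left' one_le_two)
    exact one_div_le_one_div_of_le (by positivity) (Real.sqrt_le_sqrt hxA)
  rw [kappa]
  split_ifs with hc1 hc2
  · rw [ht0, ← ENNReal.ofReal_inv_of_pos (by positivity), h2, ← ENNReal.ofReal_mul (by norm_num)]
    refine ENNReal.ofReal_le_ofReal ?_
    rw [hq0, h3, ← ENNReal.ofReal_mul (by norm_num), ENNReal.ofReal_le_ofReal_iff hA.le] at hc1
    have h4 : √(A / 4) ≤ √B := Real.sqrt_le_sqrt (by linarith)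
    have h5 : √(A / 4) = √A / 2 := by
      rw [Real.sqrt_div hA.le, show (4 : ℝ) = 2 ^ 2 by norm_num, Real.sqrt_sq (by norm_num)]
    have h6 : √A / 2 ≤ √(√A * √B) := by
      refine Real.le_sqrt_of_sq_le ?_
      have : 0 < √A := Real.sqrt_pos.2 hA
      nlinarith
    have := one_div_le_one_div_of_le (by positivity) h6
    rwa [one_div_div, div_eq_mul_inv 2] at this
  · rw [ht1, ← ENNReal.ofReal_mul hp.le, hrpow _ (by positivity)]
    exact hweak _ (by positivity) (by gcongr)
  · rw [← ENNReal.ofReal_mul hp.le, hrpow _ (by positivity)]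
    exact hweak _ (by positivity) (by gcongr)

end Kappa

/-! ### Gaussian measures of balls -/

section Balls

variable {H : Type*} [NormedAddCommGroup H] [InnerProductSpace ℝ H] [CompleteSpace H]
  [TopologicalSpace.SeparableSpace H] [MeasurableSpace H] [BorelSpace H]

/-- The constant in the comparison of two Gaussian measures on balls. -/
def ballConst : ℝ := 4 * compConst * rateConst

lemma ballConst_pos : 0 < ballConst := by
  have h1 := compConst_pos
  have h2 := one_le_rateConst
  rw [ballConst]; positivity

lemma ofReal_abs_measureReal_ball_sub_le (μ ν : Measure H) [IsGaussian μ] [IsGaussian ν]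
    (hμ : ∫ z, z ∂μ = 0) (hν : ∫ z, z ∂ν = 0) (a : H) (y : ℝ) :
    ENNReal.ofReal |μ.real {z | ‖z - a‖ ^ 2 ≤ y} - ν.real {z | ‖z - a‖ ^ 2 ≤ y}| ≤
      ENNReal.ofReal ballConst * (kappa (covarianceOperator μ) + kappa (covarianceOperator ν)) *
        (eigenvalueDist (covarianceOperator μ) (covarianceOperator ν) +
          ENNReal.ofReal (‖a‖ ^ 2)) := by
  obtain ⟨hl, hl0, hls, b, r, hr, hb, hF⟩ := exists_tendsto_quadLaw hμ a
  obtain ⟨hm, hm0, hms, b', r', hr', hb', hG⟩ := exists_tendsto_quadLaw hν a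
  have hC := ballConst_pos
  set S := covarianceOperator μ
  set T := covarianceOperator ν
  have hsum : Summable fun j => |eigenvalue S j - eigenvalue T j| := (hls.sub hms).abs
  have hdist : eigenvalueDist S T = ENNReal.ofReal (∑' j, |eigenvalue S j - eigenvalue T j|) := by
    rw [eigenvalueDist, ENNReal.ofReal_tsum_of_nonneg (fun _ => abs_nonneg _) hsum]
  by_cases hκ : kappa S + kappa T = ∞
  · by_cases hD : eigenvalueDist S T + ENNReal.ofReal (‖a‖ ^ 2) = 0
    -- Here `∞ * 0 = 0` and equality must be proved: the spectra coincide and `a = 0`, so both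
    -- distribution functions are limits of the same sequence.
    · obtain ⟨hD1, hD2⟩ := add_eq_zero.1 hD
      have ha : ‖a‖ ^ 2 ≤ 0 := ENNReal.ofReal_eq_zero.1 hD2
      have hST : eigenvalue S = eigenvalue T := funext fun j => by
        have := ENNReal.ofReal_eq_zero.1 (ENNReal.tsum_eq_zero.1 hD1 j)
        exact sub_eq_zero.1 (abs_nonpos_iff.1 this)
      have hzero : ∀ {b : ℕ → ℝ} {r : ℝ}, 0 ≤ r →
          (∀ n, ∑ k ∈ Finset.range n, b k ^ 2 + r ≤ ‖a‖ ^ 2) → b = 0 ∧ r = 0 := by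
        intro b r hr hb
        refine ⟨funext fun k => ?_, le_antisymm (by simpa using (hb 0).trans ha) hr⟩
        have h1 := Finset.single_le_sum (f := fun k => b k ^ 2) (fun _ _ => sq_nonneg _)
          (Finset.self_mem_range_succ k)
        exact pow_eq_zero_iff two_ne_zero |>.1
          (le_antisymm (by linarith [hb (k + 1)]) (sq_nonneg (b k)))
      obtain ⟨rfl, rfl⟩ := hzero hr hb
      obtain ⟨rfl, rfl⟩ := hzero hr' hb'
      have h1 := hF y
      rw [hST] at h1
      rw [tendsto_nhds_unique h1 (hG y)]
      simp
    · rw [hκ, ENNReal.mul_top (by simpa using hC), ENNReal.top_mul hD]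
      exact le_top
  · obtain ⟨hκS, hκT⟩ := ENNReal.add_ne_top.1 hκ
    have hl1 := eigenvalue_one_pos_of_kappa_ne_top hl hl0 hls hκS
    have hm1 := eigenvalue_one_pos_of_kappa_ne_top hm hm0 hms hκT
    have h1 := abs_sub_le_of_tendsto_quadLaw hl hl0 hls hl1 hm hm0 hms hm1 hr hb hr' hb' (hF y)
      (hG y)
    have hdS := density_nonneg (eigenvalue S)
    have hdT := density_nonneg (eigenvalue T)
    -- The factor `2⁻¹` is set aside to absorb the `2` in `ofReal_density_le`.
    have h2 : compConst * (2 * rateConst) = ballConst * 2⁻¹ := by rw [ballConst]; ring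
    rw [h2] at h1
    refine (ENNReal.ofReal_le_ofReal h1).trans ?_
    rw [ENNReal.ofReal_mul (by positivity), ENNReal.ofReal_mul (by positivity),
      ENNReal.ofReal_mul hC.le, ENNReal.ofReal_add hdS hdT,
      ENNReal.ofReal_add (tsum_nonneg fun _ => abs_nonneg _) (sq_nonneg _), ← hdist, mul_assoc
      (ENNReal.ofReal ballConst)]
    gcongr
    have h3 := add_le_add (ofReal_density_le hl hl0 hls hl1) (ofReal_density_le hm hm0 hms hm1)
    rw [← mul_add] at h3
    calc _ ≤ ENNReal.ofReal 2⁻¹ * (2 * (kappa S + kappa T)) := by gcongr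
      _ = kappa S + kappa T := by
        rw [← mul_assoc, ENNReal.ofReal_inv_of_pos two_pos, ENNReal.ofReal_ofNat,
          ENNReal.inv_mul_cancel two_ne_zero ENNReal.ofNat_ne_top, one_mul]

end Balls

lemma measureReal_norm_sub_le_eq {H : Type*} [NormedAddCommGroup H] [MeasurableSpace H]
    [BorelSpace H] {Ω : Type*} [MeasurableSpace Ω] {P : Measure Ω} {ξ : Ω → H}
    (hξ : AEMeasurable ξ P) (a : H) {x : ℝ} (hx : 0 < x) :
    P.real {ω | ‖ξ ω - a‖ ≤ x} = (P.map ξ).real {z | ‖z - a‖ ^ 2 ≤ x ^ 2} := by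
  have hm : MeasurableSet {z : H | ‖z - a‖ ^ 2 ≤ x ^ 2} :=
    measurableSet_le (by fun_prop) measurable_const
  rw [map_measureReal_apply_of_aemeasurable hξ hm]
  congr 1
  ext ω
  exact (pow_le_pow_iff_left₀ (norm_nonneg _) hx.le two_ne_zero).symm

end GaussianBalls

end

theorem mainTheorem7 :
    ∃ C : ℝ≥0, ∀ (H : Type*) [NormedAddCommGroup H] [InnerProductSpace ℝ H] [CompleteSpace H]
      [TopologicalSpace.SeparableSpace H] [MeasurableSpace H] [BorelSpace H]
      (Ω : Type*) [MeasurableSpace Ω] (P : Measure Ω) [IsProbabilityMeasure P]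
      (ξ η : Ω → H) (hξ : HasGaussianLaw ξ P) (hη : HasGaussianLaw η P)
      (hξ0 : ∫ ω, ξ ω ∂P = 0) (hη0 : ∫ ω, η ω ∂P = 0)
      (Sξ Sη : H →L[ℝ] H) (hSξ : Sξ = covarianceOperator (P.map ξ))
      (hSη : Sη = covarianceOperator (P.map η)) (a : H),
      (⨆ x : {x : ℝ // 0 < x},
        ENNReal.ofReal |P.real {ω | ‖ξ ω - a‖ ≤ x} - P.real {ω | ‖η ω - a‖ ≤ x}|) ≤
      C * (GaussianBalls.kappa Sξ + GaussianBalls.kappa Sη) *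
        (GaussianBalls.eigenvalueDist Sξ Sη + ENNReal.ofReal (‖a‖ ^ 2)) := by
  refine ⟨Real.toNNReal GaussianBalls.ballConst, ?_⟩
  rintro H _ _ _ _ _ _ Ω _ P _ ξ η hξ hη hξ0 hη0 _ _ rfl rfl a
  refine iSup_le fun x => ?_
  have := hξ.isGaussian_map
  have := hη.isGaussian_map
  rw [GaussianBalls.measureReal_norm_sub_le_eq hξ.aemeasurable a x.2,
    GaussianBalls.measureReal_norm_sub_le_eq hη.aemeasurable a x.2]
  refine GaussianBalls.ofReal_abs_measureReal_ball_sub_le (P.map ξ) (P.map η) ?_ ?_ a _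
  · rw [integral_map hξ.aemeasurable (f := fun z : H => z) (by fun_prop)]
    exact hξ0
  · rw [integral_map hη.aemeasurable (f := fun z : H => z) (by fun_prop)]
    exact hη0
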